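/- **Setting.** Let $(I,\mathbb A,m)$ be a finite measure space and write $|Q|=m(Q)$. A *grid* is a sequence $\mathcal P=(\mathcal P^k)_{k\ge 0}$ of finite families of measurable sets of positive measure, not all empty, no set belonging to two different levels, with $M:=\sup_k\sup_{Q\in\mathcal P^k}\#\{P\in\mathcal P^k: P\cap Q\ne\emptyset\}<\infty$. Put $|\mathcal P^k|=\sup_{Q\in\mathcal P^k}|Q|$. For $0<\lambda_1<\lambda_2<1$ the grid is a $(\lambda_1,\lambda_2)$-*good grid* if $\mathcal P^0=\{I\}$; each $\mathcal P^k$ covers $I$ up to a null set and consists of pairwise disjoint sets; every $Q\in\mathcal P^{k+1}$ is contained in some $P\in\mathcal P^k$; $\lambda_1\le |Q|/|P|\le\lambda_2$ whenever $Q\in\mathcal P^{k+1}$, $P\in\mathcal P^k$, $Q\subset P$; and $\bigcup_k\mathcal P^k$ generates $\mathbb A$. Fix a $(\lambda_1,\lambda_2)$-good grid. For $s>0$, $p\in[1,\infty)$, an $(s,p)$-*Souza's atom* on $Q$ is a function $a\colon I\to\mathbb C$ that vanishes outside $Q$, is constant on $Q$, and satisfies $|a|_\infty\le|Q|^{s-1/p}$.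 For $q\in[1,\infty]$ the space $\mathcal B^s_{p,q}$ consists of all $f\in L^p(m)$ that have a representation $f=\sum_k\sum_{Q\in\mathcal P^k}c_Qa_Q$ with $c_Q\in\mathbb C$, $a_Q$ an $(s,p)$-Souza's atom on $Q$, absolutely convergent in $L^p$ (that is, $\sum_k|\sum_{Q\in\mathcal P^k}c_Qa_Q|_p<\infty$), and with finite cost $\big(\sum_k(\sum_{Q\in\mathcal P^k}|c_Q|^p)^{q/p}\big)^{1/q}$ (with a supremum over $k$ if $q=\infty$). The norm $|f|_{\mathcal B^s_{p,q}}$ is the infimum of the costs of all such representations of $f$. **Proposition 16.6 (Pointwise multipliers II).** Let $p\in[1,\infty)$, $q\in[1,\infty]$, $0<s<1/p$, and let $g\in\mathcal B^{1/p}_{p,\infty}\cap L^\infty$. Then $G(f)=gf$ is a well defined and bounded operator $G\colon\mathcal B^s_{p,q}\to\mathcal B^s_{p,q}$, and $$|G|_{\mathcal B^s_{p,q}}=\sup\{|gf|_{\mathcal B^s_{p,q}}: |f|_{\mathcal B^s_{p,q}}\le 1\}\le C_e\,C_{no}\,\frac{|g|_{\mathcal B^{1/p}_{p,\infty}}}{1-\lambda_2^{1/p-s}}+|g|_\infty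 ,$$ and indeed $|gf|_{\mathcal B^s_{p,q}}$ is at most the right-hand side times $|f|_{\mathcal B^s_{p,q}}$ for every $f\in\mathcal B^s_{p,q}$. Here the constants, which do not depend on $s$, $q$ or $g$, are $$C_e=1+\Big(\frac{\lambda_2^{1/2}}{\sqrt2\,\lambda_1^{3/2}}+1\Big)\lambda_1^{-2-1/p},\qquad C_{no}=M^{1+1/p}\Big(\sum_{k\ge0}|\mathcal P^k|^{1/p}\Big)|I|^{-1/p}+\frac1{1-\lambda_2^{1/p}} .$$ -/

import Mathlib

open MeasureTheory Filter Topology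
open scoped ENNReal

noncomputable section

/-- A grid on the measure space `(I, μ)`: a sequence of finite families of measurable sets of
positive measure, not all of them empty, no set occurring at two different levels, such that the
number of sets of a level that meet a given set of the same level is bounded. -/
structure Grid {I : Type*} [MeasurableSpace I] (μ : Measure I) where
  /-- the `k`-th family -/
  cells : ℕ → Finset (Set I)
  measurable_cells : ∀ k, ∀ Q ∈ cells k, MeasurableSet Q
  measure_pos : ∀ k, ∀ Q ∈ cells k, 0 < μ Q
  exists_nonempty : ∃ k, (cells k).Nonempty
  level_ne : ∀ i j, i ≠ j → ∀ P ∈ cells i, ∀ Q ∈ cells j, P ≠ Q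
  bounded_overlap : ∃ N : ℕ, ∀ k, ∀ Q ∈ cells k,
    Set.ncard {P : Set I | P ∈ cells k ∧ (P ∩ Q).Nonempty} ≤ N

namespace Grid

variable {I : Type*} [MeasurableSpace I] {μ : Measure I}

/-- The overlap constant of a grid: the largest number of sets of a level that meet a given set of
that level (the set below is bounded by `bounded_overlap`). -/
def overlap (P : Grid μ) : ℕ :=
  sSup {n : ℕ | ∃ k, ∃ Q ∈ P.cells k,
    n = Set.ncard {R : Set I | R ∈ P.cells k ∧ (R ∩ Q).Nonempty}}

/-- The largest measure of a set of level `k`. -/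
def mesh (P : Grid μ) (k : ℕ) : ℝ :=
  ⨆ Q : P.cells k, μ.real (Q : Set I)

/-- `(l₁, l₂)`-good grids. -/
structure IsGood (P : Grid μ) (l₁ l₂ : ℝ) : Prop where
  pos : 0 < l₁
  lt : l₁ < l₂
  lt_one : l₂ < 1
  zero_level : P.cells 0 = {Set.univ}
  cover : ∀ k, μ (⋃ Q ∈ P.cells k, Q)ᶜ = 0
  disjoint : ∀ k, (P.cells k : Set (Set I)).PairwiseDisjoint id
  nested : ∀ k, ∀ Q ∈ P.cells (k + 1), ∃ R ∈ P.cells k, Q ⊆ R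
  ratio : ∀ k, ∀ Q ∈ P.cells (k + 1), ∀ R ∈ P.cells k, Q ⊆ R →
    l₁ ≤ μ.real Q / μ.real R ∧ μ.real Q / μ.real R ≤ l₂
  generates : MeasurableSpace.generateFrom (⋃ k, (P.cells k : Set (Set I))) = ‹MeasurableSpace I›

/-- The norm of `ℓ_q(ℓ_p^P)`:
`(∑ k, (∑ Q ∈ P^k, |c Q| ^ p) ^ (q / p)) ^ (1 / q)`, with a supremum over `k` if `q = ∞`. -/
def cost (P : Grid μ) (p : ℝ) (q : ℝ≥0∞) (c : Set I → ℂ) : ℝ≥0∞ :=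
  if q = ∞ then ⨆ k, (∑ Q ∈ P.cells k, ‖c Q‖ₑ ^ p) ^ (1 / p)
  else (∑' k, (∑ Q ∈ P.cells k, ‖c Q‖ₑ ^ p) ^ (q.toReal / p)) ^ (1 / q.toReal)

/-- The `k`-th block `∑ Q ∈ P^k, c Q • a Q` of an atomic series. -/
def block (P : Grid μ) (c : Set I → ℂ) (a : Set I → I → ℂ) (k : ℕ) (x : I) : ℂ :=
  ∑ Q ∈ P.cells k, c Q * a Q x

end Grid

/-- `(s, p)`-Souza's atoms supported on `Q`: functions that vanish outside `Q`, are constant on `Q`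
and are bounded by `|Q| ^ (s - 1 / p)`. -/
def IsSouzaAtom {I : Type*} [MeasurableSpace I] (μ : Measure I) (s p : ℝ) (Q : Set I)
    (a : I → ℂ) : Prop :=
  (∀ x, x ∉ Q → a x = 0) ∧ (∃ z : ℂ, ∀ x ∈ Q, a x = z) ∧
    ∀ x, ‖a x‖ ≤ μ.real Q ^ (s - 1 / p)

namespace Grid

variable {I : Type*} [MeasurableSpace I] {μ : Measure I}

/-- For `1 ≤ p < ∞`: `∑ k, ∑ Q ∈ P^k, c Q • a Q` is a representation of `f` in the Besov space
with parameters `s, p, q`: the `a Q` are `(s, p)`-Souza's atoms, the cost is finite, and the series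
of the blocks converges absolutely in `L^p`, with sum `f`. -/
structure IsRepresentation (P : Grid μ) (s p : ℝ) (q : ℝ≥0∞) (f : I → ℂ)
    (c : Set I → ℂ) (a : Set I → I → ℂ) : Prop where
  atoms : ∀ k, ∀ Q ∈ P.cells k, IsSouzaAtom μ s p Q (a Q)
  cost_lt_top : P.cost p q c < ∞
  abs_conv : ∑' k, eLpNorm (P.block c a k) (ENNReal.ofReal p) μ < ∞
  tendsto : Tendsto
    (fun n : ℕ => eLpNorm (fun x => f x - ∑ k ∈ Finset.range n, P.block c a k x)
      (ENNReal.ofReal p) μ) atTop (𝓝 0)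

/-- Membership in the Besov space `B^s_{p,q}` of the grid (for `1 ≤ p < ∞`); it is invariant under
changes of `f` on null sets. -/
def MemBesov (P : Grid μ) (s p : ℝ) (q : ℝ≥0∞) (f : I → ℂ) : Prop :=
  MemLp f (ENNReal.ofReal p) μ ∧ ∃ c a, P.IsRepresentation s p q f c a

/-- The norm of `B^s_{p,q}`: the infimum of the costs of all representations. It is meant for
members of the space, where the infimum is finite. -/
def besovNorm (P : Grid μ) (s p : ℝ) (q : ℝ≥0∞) (f : I → ℂ) : ℝ :=
  (⨅ (c : Set I → ℂ) (a : Set I → I → ℂ) (_ : P.IsRepresentation s p q f c a),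
    P.cost p q c).toReal

/-- The operator norm of the multiplication by `g` on `B^s_{p,q}`: the supremum of
`|g f|` over all `f` in the space with `|f| ≤ 1`. -/
def multiplierNorm (P : Grid μ) (s p : ℝ) (q : ℝ≥0∞) (g : I → ℂ) : ℝ :=
  sSup {r : ℝ | ∃ f : I → ℂ, P.MemBesov s p q f ∧ P.besovNorm s p q f ≤ 1 ∧
    r = P.besovNorm s p q (fun x => g x * f x)}

end Grid

/-- The constant of Hölder's inequality for `1 ≤ t` and `1 ≤ q ≤ ∞`, with `1 / q + 1 / q' = 1`:
`(∑ k, b k ^ (q' / t)) ^ (1 / q')` if `q > 1`, and `sup k, b k ^ (1 / t)` if `q = 1`. -/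
def holderConst (t : ℝ) (q : ℝ≥0∞) (b : ℕ → ℝ) : ℝ :=
  if q = 1 then ⨆ k, b k ^ (1 / t)
  else
    let q' : ℝ := (1 - q⁻¹.toReal)⁻¹
    (∑' k, b k ^ (q' / t)) ^ (1 / q')

/-- The constant that bounds the Haar functions of an `(l₁, l₂)`-good grid:
`l₂ ^ (1 / 2) / (√2 l₁ ^ (3 / 2)) + 1`. -/
def haarConst (l₁ l₂ : ℝ) : ℝ :=
  l₂ ^ (1 / 2 : ℝ) / (√2 * l₁ ^ (3 / 2 : ℝ)) + 1

/-- The constant in the estimate of the standard atomic norm by the Haar norm. -/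
def standardConst (l₁ l₂ s p : ℝ) : ℝ :=
  1 + haarConst l₁ l₂ * max (l₂ ^ (1 / p - s)) (l₁ ^ (1 / p - s)) * l₁ ^ (-2 - 1 / p)

/-- The constant in the estimate of the mean oscillation norm by the Besov norm. For an
`(l₁, l₂)`-good grid the mesh decays geometrically, so the series in it converges. -/
def oscConst {I : Type*} [MeasurableSpace I] {μ : Measure I} (P : Grid μ) (l₂ s p : ℝ)
    (q : ℝ≥0∞) : ℝ :=
  (P.overlap : ℝ) ^ (1 + 1 / p) * holderConst p q (fun k => P.mesh k ^ (s * p)) *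
      μ.real Set.univ ^ (-s) +
    1 / (1 - l₂ ^ s)

end

/-! Write `E_k g` for the function equal to the mean of `g` on each cell of level `k` (`cellMean`),
`f_k` for the blocks of a representation of `f`, and `F_n = ∑_{k<n} f_k`. The products `E_{n-1} g ·
F_n` tend to `g f` in `L^p`, and their increments are `E_k g · f_k + (E_k g - E_{k-1} g) · F_k`,
which is constant on each cell of level `k`. Hence these increments are blocks of an atomic series
for `g f` (`isRepresentation_of_isStep`), and only its coefficients remain to be estimated.

The first term costs at most `|g|_∞` times the cost of `f`. In the second, `|F_k|` on a cell `R`,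
scaled by `|R|^(1/p-s)`, is at most a convolution of the coefficient norms of `f` with powers of `θ
= l₂^(1/p-s)` (`enorm_partialSum_mul_le`), whose `ℓ^q` norm loses a factor `1/(1-θ)`
(`seqNorm_le_of_recurrence`). The jumps `E_k g - E_{k-1} g` have `ℓ^p` norm over the cells of each
level bounded by a multiple of the norm of `g` in `B^{1/p}_{p,∞}` (`levelNorm_jump_le`): the blocks
of `g` up to level `k-1` do not contribute to the jump, and the later ones decay geometrically when
every cell of level `k` is given mass one.

This yields the constant `(1 + l₁^(-1/p)) / (1 - l₂^(1/p))`, which is at most `C_e C_no`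
(`jumpConst_le`). Infima over the representations of `g` and of `f` conclude. -/

noncomputable section

/-! ### Norms of sequences and a discrete Young inequality. -/

/-- The `ℓ^q` norm of a sequence of extended nonnegative numbers. -/
def seqNorm (q : ℝ≥0∞) (b : ℕ → ℝ≥0∞) : ℝ≥0∞ :=
  if q = ∞ then ⨆ k, b k else (∑' k, b k ^ q.toReal) ^ (1 / q.toReal)

theorem one_le_toReal_of_ne_top {q : ℝ≥0∞} (hq : 1 ≤ q) (h : q ≠ ∞) : 1 ≤ q.toReal := by
  have := ENNReal.toReal_mono h hq
  simpa using this

theorem le_seqNorm {q : ℝ≥0∞} (hq : 1 ≤ q) (b : ℕ → ℝ≥0∞) (k : ℕ) : b k ≤ seqNorm q b := by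
  unfold seqNorm
  split_ifs with h
  · exact le_iSup b k
  · have h1 := one_le_toReal_of_ne_top hq h
    have h0 : 0 < q.toReal := by linarith
    rw [one_div, ENNReal.le_rpow_inv_iff h0]
    exact ENNReal.le_tsum k

theorem seqNorm_mono {q : ℝ≥0∞} {a b : ℕ → ℝ≥0∞} (h : ∀ k, a k ≤ b k) :
    seqNorm q a ≤ seqNorm q b := by
  unfold seqNorm
  split_ifs with hq
  · exact iSup_mono h
  · gcongr with k
    exact h k

theorem seqNorm_le_of_forall_range {q : ℝ≥0∞} (h : q ≠ ∞) (hq : 1 ≤ q) {b : ℕ → ℝ≥0∞} {C : ℝ≥0∞}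
    (hC : ∀ n, (∑ k ∈ Finset.range n, b k ^ q.toReal) ^ (1 / q.toReal) ≤ C) :
    seqNorm q b ≤ C := by
  have h1 := one_le_toReal_of_ne_top hq h
  have h0 : 0 < q.toReal := by linarith
  simp only [seqNorm, if_neg h]
  rw [one_div, ENNReal.rpow_inv_le_iff h0, ENNReal.tsum_eq_iSup_nat]
  refine iSup_le fun n => ?_
  rw [← ENNReal.rpow_inv_le_iff h0, ← one_div]
  exact hC n

theorem range_le_seqNorm {q : ℝ≥0∞} (h : q ≠ ∞) (b : ℕ → ℝ≥0∞) (n : ℕ) :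
    (∑ k ∈ Finset.range n, b k ^ q.toReal) ^ (1 / q.toReal) ≤ seqNorm q b := by
  simp only [seqNorm, if_neg h]
  gcongr
  exact ENNReal.sum_le_tsum _

theorem finset_Lp_const_mul {ι : Type*} (t : Finset ι) (f : ι → ℝ≥0∞) (C : ℝ≥0∞) {r : ℝ}
    (hr : 0 < r) :
    (∑ i ∈ t, (C * f i) ^ r) ^ (1 / r) = C * (∑ i ∈ t, f i ^ r) ^ (1 / r) := by
  simp_rw [ENNReal.mul_rpow_of_nonneg _ _ hr.le]
  rw [← Finset.mul_sum, ENNReal.mul_rpow_of_nonneg _ _ (by positivity), ← ENNReal.rpow_mul,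
    mul_one_div_cancel hr.ne', ENNReal.rpow_one]

theorem seqNorm_const_mul_le {q : ℝ≥0∞} (hq : 1 ≤ q) (a : ℕ → ℝ≥0∞) (C : ℝ≥0∞) :
    seqNorm q (fun k => C * a k) ≤ C * seqNorm q a := by
  by_cases h : q = ∞
  · simp only [seqNorm, if_pos h]
    exact iSup_le fun k => mul_le_mul_right (le_iSup a k) C
  · refine seqNorm_le_of_forall_range h hq fun n => ?_
    have h1 := one_le_toReal_of_ne_top hq h
    rw [finset_Lp_const_mul _ _ _ (by linarith)]
    gcongr
    exact range_le_seqNorm h a n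

theorem seqNorm_add_le {q : ℝ≥0∞} (hq : 1 ≤ q) (a b : ℕ → ℝ≥0∞) :
    seqNorm q (fun k => a k + b k) ≤ seqNorm q a + seqNorm q b := by
  by_cases h : q = ∞
  · simp only [seqNorm, if_pos h]
    exact iSup_le fun k => add_le_add (le_iSup a k) (le_iSup b k)
  · refine seqNorm_le_of_forall_range h hq fun n => ?_
    refine (ENNReal.Lp_add_le _ a b (one_le_toReal_of_ne_top hq h)).trans ?_
    gcongr
    · exact range_le_seqNorm h a n
    · exact range_le_seqNorm h b n

/-- A discrete form of Young's inequality for the convolution with a geometric sequence. -/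
theorem seqNorm_le_of_recurrence {q : ℝ≥0∞} (hq : 1 ≤ q) {x b : ℕ → ℝ≥0∞} {θ C : ℝ≥0∞}
    (hC : θ * (C + 1) ≤ C) (h0 : x 0 = 0) (hx : ∀ k, x (k + 1) = θ * (x k + b k)) :
    seqNorm q x ≤ C * seqNorm q b := by
  set B := seqNorm q b with hB
  -- The bound `C * B` is preserved by the recurrence, so it propagates by induction.
  have key : θ * (C * B + B) ≤ C * B := by
    calc θ * (C * B + B) = θ * (C + 1) * B := by ring
      _ ≤ C * B := by gcongr
  by_cases h : q = ∞
  · have : ∀ k, x k ≤ C * B := by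
      intro k
      induction k with
      | zero => simp [h0]
      | succ k ih =>
        rw [hx]
        refine le_trans ?_ key
        gcongr
        exact le_seqNorm hq b k
    simp only [seqNorm, if_pos h]
    exact iSup_le this
  · refine seqNorm_le_of_forall_range h hq fun n => ?_
    have h1 := one_le_toReal_of_ne_top hq h
    have hr : 0 < q.toReal := by linarith
    induction n with
    | zero => simp [hr]
    | succ n ih =>
      -- Dropping the vanishing term `x 0` shifts the index, so the norm of `n + 1` terms of `x` is
      -- `θ` times that of `n` terms of `x + b`.
      rw [Finset.sum_range_succ', h0, ENNReal.zero_rpow_of_pos hr, add_zero]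
      simp_rw [hx]
      rw [finset_Lp_const_mul _ _ _ hr]
      refine le_trans ?_ key
      gcongr
      refine (ENNReal.Lp_add_le _ x b h1).trans ?_
      gcongr
      exact range_le_seqNorm h b n

theorem finset_Lp_le_of_le_add {ι : Type*} (t : Finset ι) {f a b : ι → ℝ≥0∞} {C D : ℝ≥0∞} {p : ℝ}
    (hp : 1 ≤ p) (h : ∀ i ∈ t, f i ≤ C * a i + D * b i) :
    (∑ i ∈ t, f i ^ p) ^ (1 / p) ≤
      C * (∑ i ∈ t, a i ^ p) ^ (1 / p) + D * (∑ i ∈ t, b i ^ p) ^ (1 / p) := by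
  have hp0 : 0 < p := by linarith
  rw [← finset_Lp_const_mul _ _ _ hp0, ← finset_Lp_const_mul _ _ _ hp0]
  refine le_trans ?_ (ENNReal.Lp_add_le t _ _ hp)
  gcongr with i hi
  exact h i hi

theorem eLpNorm_ofReal_eq {α E : Type*} [MeasurableSpace α] [NormedAddCommGroup E] {p : ℝ}
    (hp : 0 < p) (f : α → E) (ν : Measure α) :
    eLpNorm f (ENNReal.ofReal p) ν = (∫⁻ x, ‖f x‖ₑ ^ p ∂ν) ^ (1 / p) := by
  rw [eLpNorm_eq_lintegral_rpow_enorm_toReal (by simpa using hp) ENNReal.ofReal_ne_top,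
    ENNReal.toReal_ofReal hp.le]

/-! ### Cells, cell means and step functions. -/

namespace Grid

variable {I : Type*} [MeasurableSpace I] {μ : Measure I}

/-- The `ℓ^p` norm of the coefficients of level `k`. -/
def levelNorm (P : Grid μ) (p : ℝ) (c : Set I → ℂ) (k : ℕ) : ℝ≥0∞ :=
  (∑ Q ∈ P.cells k, ‖c Q‖ₑ ^ p) ^ (1 / p)

theorem cost_eq_seqNorm (P : Grid μ) {p : ℝ} {q : ℝ≥0∞} (c : Set I → ℂ) :
    P.cost p q c = seqNorm q (P.levelNorm p c) := by
  unfold cost seqNorm levelNorm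
  split_ifs
  · rfl
  · simp_rw [← ENNReal.rpow_mul]
    simp_rw [div_mul_eq_mul_div, one_mul]

theorem enorm_le_levelNorm (P : Grid μ) {p : ℝ} (hp : 0 < p) (c : Set I → ℂ) {k : ℕ} {Q : Set I}
    (hQ : Q ∈ P.cells k) : ‖c Q‖ₑ ≤ P.levelNorm p c k := by
  unfold levelNorm
  rw [one_div, ENNReal.le_rpow_inv_iff hp]
  exact Finset.single_le_sum (f := fun Q => ‖c Q‖ₑ ^ p) (fun _ _ => zero_le) hQ

/-- The sum of the restrictions of `μ` to the cells of level `k`, with weights `w`. -/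
def weighted (P : Grid μ) (w : Set I → ℝ≥0∞) (k : ℕ) : Measure I :=
  ∑ R ∈ P.cells k, w R • μ.restrict R

/-- The function that is equal to the mean of `f` on each cell of level `k`. -/
def cellMean (P : Grid μ) (k : ℕ) (f : I → ℂ) (x : I) : ℂ :=
  ∑ R ∈ P.cells k, R.indicator (fun _ => ⨍ y in R, f y ∂μ) x

/-- Functions that are constant on each cell of level `k`. -/
def IsStep (P : Grid μ) (k : ℕ) (h : I → ℂ) : Prop :=
  ∀ R ∈ P.cells k, ∀ x ∈ R, ∀ y ∈ R, h x = h y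

theorem lintegral_weighted (P : Grid μ) (w : Set I → ℝ≥0∞) (k : ℕ) (φ : I → ℝ≥0∞) :
    ∫⁻ x, φ x ∂P.weighted w k = ∑ R ∈ P.cells k, w R * ∫⁻ x in R, φ x ∂μ := by
  simp [weighted, lintegral_finsetSum_measure, lintegral_smul_measure]

theorem weighted_absolutelyContinuous (P : Grid μ) (w : Set I → ℝ≥0∞) (k : ℕ) :
    P.weighted w k ≪ μ := by
  refine Measure.AbsolutelyContinuous.mk fun s _ h0 => ?_
  simp only [weighted, Measure.finsetSum_apply, Measure.smul_apply, smul_eq_mul]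
  refine Finset.sum_eq_zero fun R _ => ?_
  rw [Measure.restrict_le_self.absolutelyContinuous h0, mul_zero]

namespace IsGood

variable {P : Grid μ} {l₁ l₂ : ℝ} (hP : P.IsGood l₁ l₂)
include hP

theorem l₂_pos : 0 < l₂ := hP.pos.trans hP.lt

theorem eq_of_mem {k : ℕ} {R Q : Set I} (hR : R ∈ P.cells k) (hQ : Q ∈ P.cells k) {x : I}
    (hxR : x ∈ R) (hxQ : x ∈ Q) : R = Q := by
  by_contra h
  exact Set.disjoint_left.1 (hP.disjoint k hR hQ h) hxR hxQ

theorem sum_eq_of_mem {M : Type*} [AddCommMonoid M] {k : ℕ} {R : Set I} (hR : R ∈ P.cells k)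
    {x : I} (hx : x ∈ R) (φ : Set I → M) (hφ : ∀ Q ∈ P.cells k, x ∉ Q → φ Q = 0) :
    ∑ Q ∈ P.cells k, φ Q = φ R := by
  refine Finset.sum_eq_single R (fun Q hQ hne => hφ Q hQ fun hxQ => hne ?_) (fun h => (h hR).elim)
  exact hP.eq_of_mem hQ hR hxQ hx

theorem ae_mem_cell (k : ℕ) : ∀ᵐ x ∂μ, ∃ R ∈ P.cells k, x ∈ R := by
  have := hP.cover k
  rw [ae_iff]
  convert this using 2
  ext x
  simp

theorem cellMean_of_mem {k : ℕ} {R : Set I} (hR : R ∈ P.cells k) {x : I} (hx : x ∈ R)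
    (f : I → ℂ) : P.cellMean k f x = ⨍ y in R, f y ∂μ := by
  unfold cellMean
  rw [hP.sum_eq_of_mem hR hx (fun R => R.indicator (fun _ => ⨍ y in R, f y ∂μ) x)
    fun Q _ h => Set.indicator_of_notMem h _, Set.indicator_of_mem hx]

theorem isStep_cellMean (k : ℕ) (f : I → ℂ) : P.IsStep k (P.cellMean k f) := by
  intro R hR x hx y hy
  rw [hP.cellMean_of_mem hR hx, hP.cellMean_of_mem hR hy]

theorem block_of_mem {k : ℕ} {R : Set I} (hR : R ∈ P.cells k) {x : I} (hx : x ∈ R)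
    {s p : ℝ} {c : Set I → ℂ} {a : Set I → I → ℂ} (ha : ∀ Q ∈ P.cells k, IsSouzaAtom μ s p Q (a Q)) :
    P.block c a k x = c R * a R x := by
  unfold block
  exact hP.sum_eq_of_mem hR hx (fun Q => c Q * a Q x) fun Q hQ h => by rw [(ha Q hQ).1 x h, mul_zero]

theorem isStep_block {k : ℕ} {s p : ℝ} {c : Set I → ℂ} {a : Set I → I → ℂ}
    (ha : ∀ Q ∈ P.cells k, IsSouzaAtom μ s p Q (a Q)) : P.IsStep k (P.block c a k) := by
  intro R hR x hx y hy
  obtain ⟨z, hz⟩ := (ha R hR).2.1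
  rw [hP.block_of_mem hR hx ha, hP.block_of_mem hR hy ha, hz x hx, hz y hy]

theorem isStep_mono {j k : ℕ} (hjk : j ≤ k) {h : I → ℂ} (hh : P.IsStep j h) : P.IsStep k h := by
  induction k, hjk using Nat.le_induction with
  | base => exact hh
  | succ k _ ih =>
    intro R hR x hx y hy
    obtain ⟨Q, hQ, hRQ⟩ := hP.nested k R hR
    exact ih Q hQ x (hRQ hx) y (hRQ hy)

theorem exists_ancestor {j k : ℕ} (hjk : j ≤ k) {R : Set I} (hR : R ∈ P.cells k) :
    ∃ Q ∈ P.cells j, R ⊆ Q := by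
  induction k, hjk using Nat.le_induction generalizing R with
  | base => exact ⟨R, hR, subset_rfl⟩
  | succ k _ ih =>
    obtain ⟨Q, hQ, hRQ⟩ := hP.nested k R hR
    obtain ⟨Q', hQ', h⟩ := ih hQ
    exact ⟨Q', hQ', hRQ.trans h⟩

variable [IsFiniteMeasure μ]

omit hP in
theorem _root_.Grid.measureReal_pos (P : Grid μ) {k : ℕ} {R : Set I} (hR : R ∈ P.cells k) :
    0 < μ.real R :=
  ENNReal.toReal_pos (P.measure_pos k R hR).ne' (measure_ne_top _ _)

/-- The upper ratio bound is iterated along the chain of ancestors of `R`; disjointness forces this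
chain to end at `Q`. -/
theorem measureReal_le_mul_of_subset {j k : ℕ} (hjk : j ≤ k) {R Q : Set I} (hR : R ∈ P.cells k)
    (hQ : Q ∈ P.cells j) (h : R ⊆ Q) : μ.real R ≤ l₂ ^ (k - j) * μ.real Q := by
  have hne : R.Nonempty := nonempty_of_measure_ne_zero (P.measure_pos k R hR).ne'
  obtain ⟨x, hx⟩ := hne
  induction k, hjk using Nat.le_induction generalizing R with
  | base => simp [hP.eq_of_mem hR hQ hx (h hx)]
  | succ k hk ih =>
    obtain ⟨Q', hQ', hRQ⟩ := hP.nested k R hR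
    obtain ⟨Q'', hQ'', hQQ⟩ := hP.exists_ancestor hk hQ'
    have : Q'' = Q := hP.eq_of_mem hQ'' hQ (hQQ (hRQ hx)) (h hx)
    subst this
    have h1 := ih hQ' hQQ (hRQ hx)
    have h2 := (hP.ratio k R hR Q' hQ' hRQ).2
    rw [div_le_iff₀ (P.measureReal_pos hQ')] at h2
    rw [Nat.succ_sub hk, pow_succ']
    calc μ.real R ≤ l₂ * μ.real Q' := h2
      _ ≤ l₂ * (l₂ ^ (k - j) * μ.real Q'') := by gcongr; exact hP.l₂_pos.le
      _ = _ := by ring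

end IsGood
end Grid
end

/-! ### Normalized measures and `L^p` estimates for means and blocks. -/

noncomputable section

namespace Grid

variable {I : Type*} [MeasurableSpace I] {μ : Measure I}

theorem weighted_le_smul (P : Grid μ) (w : Set I → ℝ≥0∞) (k : ℕ) :
    P.weighted w k ≤ (∑ R ∈ P.cells k, w R) • μ := by
  refine Measure.le_iff.2 fun s _ => ?_
  simp only [weighted, Measure.finsetSum_apply, Measure.smul_apply, smul_eq_mul]
  rw [Finset.sum_mul]
  gcongr
  exact Measure.restrict_le_self

theorem weighted_apply (P : Grid μ) (w : Set I → ℝ≥0∞) (k : ℕ) {s : Set I} (hs : MeasurableSet s) :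
    P.weighted w k s = ∫⁻ x in s, ∑ R ∈ P.cells k, R.indicator (fun _ => w R) x ∂μ := by
  rw [lintegral_finsetSum' _ fun R hR =>
    (measurable_const.indicator (P.measurable_cells k R hR)).aemeasurable]
  simp only [weighted, Measure.finsetSum_apply, Measure.smul_apply, smul_eq_mul]
  refine Finset.sum_congr rfl fun R hR => ?_
  rw [lintegral_indicator_const (P.measurable_cells k R hR), Measure.restrict_apply hs,
    Measure.restrict_apply (P.measurable_cells k R hR), Set.inter_comm]

/-- The measure that has mass one on each cell of level `k`. -/
def normalized (P : Grid μ) (k : ℕ) : Measure I := P.weighted (fun R => (μ R)⁻¹) k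

theorem normalized_absolutelyContinuous (P : Grid μ) (k : ℕ) : P.normalized k ≪ μ :=
  P.weighted_absolutelyContinuous _ k

variable [IsFiniteMeasure μ]

/-- Jensen's inequality for the normalized restriction of `μ` to `R`. -/
theorem enorm_setAverage_rpow_le (P : Grid μ) {p : ℝ} (hp : 1 ≤ p) {k : ℕ} {R : Set I}
    (hR : R ∈ P.cells k) {f : I → ℂ} (hf : AEStronglyMeasurable f μ) :
    ‖⨍ y in R, f y ∂μ‖ₑ ^ p ≤ (μ R)⁻¹ * ∫⁻ y in R, ‖f y‖ₑ ^ p ∂μ := by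
  have h0 := (P.measure_pos k R hR).ne'
  have hp0 : 0 < p := by linarith
  have h1 : (μ.restrict R) Set.univ = μ R := by simp
  have : IsProbabilityMeasure ((μ R)⁻¹ • μ.restrict R) :=
    ⟨by simp [ENNReal.inv_mul_cancel h0 (measure_ne_top μ R)]⟩
  have hf' : AEStronglyMeasurable f ((μ R)⁻¹ • μ.restrict R) := (hf.restrict).smul_measure _
  have h2 : ‖⨍ y in R, f y ∂μ‖ₑ ≤ (∫⁻ y, ‖f y‖ₑ ^ p ∂((μ R)⁻¹ • μ.restrict R)) ^ (1 / p) := by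
    rw [← eLpNorm_ofReal_eq hp0]
    refine le_trans ?_ (eLpNorm_le_eLpNorm_of_exponent_le (p := 1) ?_ hf')
    · rw [eLpNorm_one_eq_lintegral_enorm, average, h1]
      exact enorm_integral_le_lintegral_enorm _
    · simpa using hp
  rw [one_div, ENNReal.le_rpow_inv_iff hp0, lintegral_smul_measure] at h2
  exact h2

theorem setAverage_of_isStep (P : Grid μ) {k : ℕ} {h : I → ℂ} (hh : P.IsStep k h) {R : Set I}
    (hR : R ∈ P.cells k) {x : I} (hx : x ∈ R) : ⨍ y in R, h y ∂μ = h x := by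
  have : ⨍ y in R, h y ∂μ = ⨍ _ in R, h x ∂μ :=
    setAverage_congr_fun (P.measurable_cells k R hR)
      (Eventually.of_forall fun y hy => hh R hR y hy x hx)
  rw [this, setAverage_const (P.measure_pos k R hR).ne' (measure_ne_top _ _)]

namespace IsGood

variable {P : Grid μ} {l₁ l₂ : ℝ} (hP : P.IsGood l₁ l₂)
include hP

omit [IsFiniteMeasure μ] in
theorem weighted_one (k : ℕ) : P.weighted (fun _ => 1) k = μ := by
  refine Measure.ext fun s hs => ?_
  rw [P.weighted_apply _ k hs]
  have : ∀ᵐ x ∂μ.restrict s, ∑ R ∈ P.cells k, R.indicator (fun _ => (1 : ℝ≥0∞)) x = 1 := by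
    filter_upwards [ae_restrict_of_ae (hP.ae_mem_cell k)] with x ⟨R, hR, hx⟩
    rw [hP.sum_eq_of_mem hR hx (fun R => R.indicator (fun _ => (1 : ℝ≥0∞)) x)
      fun Q _ h => Set.indicator_of_notMem h _, Set.indicator_of_mem hx]
  rw [lintegral_congr_ae this]
  simp

omit [IsFiniteMeasure μ] in
-- Almost every point lies in exactly one cell of each level, so the densities can be compared
-- pointwise.
theorem normalized_le_normalized {j k : ℕ} {C : ℝ≥0∞}
    (h : ∀ R ∈ P.cells j, ∀ Q ∈ P.cells k, (R ∩ Q).Nonempty → (μ R)⁻¹ ≤ C * (μ Q)⁻¹) :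
    P.normalized j ≤ C • P.normalized k := by
  refine Measure.le_iff.2 fun s hs => ?_
  rw [Measure.smul_apply, normalized, normalized, P.weighted_apply _ j hs, P.weighted_apply _ k hs,
    smul_eq_mul, ← lintegral_const_mul C (Finset.measurable_fun_sum _ fun R hR =>
      measurable_const.indicator (P.measurable_cells k R hR))]
  refine lintegral_mono_ae ?_
  filter_upwards [ae_restrict_of_ae (hP.ae_mem_cell j), ae_restrict_of_ae (hP.ae_mem_cell k)]
    with x ⟨R, hR, hxR⟩ ⟨Q, hQ, hxQ⟩
  rw [hP.sum_eq_of_mem hR hxR (fun R => R.indicator (fun _ => (μ R)⁻¹) x)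
      fun Q _ h => Set.indicator_of_notMem h _, Set.indicator_of_mem hxR,
    hP.sum_eq_of_mem hQ hxQ (fun R => R.indicator (fun _ => (μ R)⁻¹) x)
      fun Q _ h => Set.indicator_of_notMem h _, Set.indicator_of_mem hxQ]
  exact h R hR Q hQ ⟨x, hxR, hxQ⟩

omit [IsFiniteMeasure μ] in
theorem subset_of_inter_nonempty {k : ℕ} {R Q : Set I} (hR : R ∈ P.cells (k + 1))
    (hQ : Q ∈ P.cells k) (h : (R ∩ Q).Nonempty) : R ⊆ Q := by
  obtain ⟨x, hx, hxQ⟩ := h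
  obtain ⟨Q', hQ', hRQ⟩ := hP.nested k R hR
  rwa [hP.eq_of_mem hQ hQ' hxQ (hRQ hx)]

omit [IsFiniteMeasure μ] in
theorem normalized_le_succ (k : ℕ) : P.normalized k ≤ P.normalized (k + 1) := by
  have := hP.normalized_le_normalized (j := k) (k := k + 1) (C := 1) fun Q hQ R hR h => by
    rw [one_mul, ENNReal.inv_le_inv]
    exact measure_mono (hP.subset_of_inter_nonempty hR hQ (by rwa [Set.inter_comm]))
  simpa using this

theorem normalized_succ_le (k : ℕ) :
    P.normalized (k + 1) ≤ ENNReal.ofReal l₁⁻¹ • P.normalized k := by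
  refine hP.normalized_le_normalized fun R hR Q hQ h => ?_
  have h1 := (hP.ratio k R hR Q hQ (hP.subset_of_inter_nonempty hR hQ h)).1
  have hQ0 := P.measureReal_pos hQ
  have hR0 := P.measureReal_pos hR
  have hl := hP.pos
  rw [← ofReal_measureReal (μ := μ) (s := R), ← ofReal_measureReal (μ := μ) (s := Q),
    ← ENNReal.ofReal_inv_of_pos hQ0, ← ENNReal.ofReal_inv_of_pos hR0,
    ← ENNReal.ofReal_mul (by positivity)]
  apply ENNReal.ofReal_le_ofReal
  rw [← mul_inv]
  gcongr
  rwa [le_div_iff₀ hQ0] at h1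

/-- On a single cell the weighted measure is a multiple of `μ`, so Jensen's inequality applies cell
by cell. The weights `1` and `(μ R)⁻¹` cover both `μ` and `normalized k`. -/
theorem eLpNorm_cellMean_le {p : ℝ} (hp : 1 ≤ p) (w : Set I → ℝ≥0∞) (k : ℕ) {f : I → ℂ}
    (hf : AEStronglyMeasurable f μ) :
    eLpNorm (P.cellMean k f) (ENNReal.ofReal p) (P.weighted w k) ≤
      eLpNorm f (ENNReal.ofReal p) (P.weighted w k) := by
  have hp0 : 0 < p := by linarith
  rw [eLpNorm_ofReal_eq hp0, eLpNorm_ofReal_eq hp0, P.lintegral_weighted, P.lintegral_weighted]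
  refine ENNReal.rpow_le_rpow (Finset.sum_le_sum fun R hR => mul_le_mul_right ?_ _) (by positivity)
  have : ∫⁻ x in R, ‖P.cellMean k f x‖ₑ ^ p ∂μ = ∫⁻ _ in R, ‖⨍ y in R, f y ∂μ‖ₑ ^ p ∂μ := by
    refine setLIntegral_congr_fun (P.measurable_cells k R hR) fun x hx => ?_
    simp only [hP.cellMean_of_mem hR hx]
  rw [this, setLIntegral_const]
  calc _ ≤ (μ R)⁻¹ * (∫⁻ y in R, ‖f y‖ₑ ^ p ∂μ) * μ R := by
        gcongr; exact P.enorm_setAverage_rpow_le hp hR hf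
    _ = _ := by
      rw [mul_comm, ← mul_assoc, ENNReal.mul_inv_cancel (P.measure_pos k R hR).ne'
        (measure_ne_top μ R), one_mul]

omit hP in
theorem _root_.Grid.levelNorm_setAverage_le (P : Grid μ) {p : ℝ} (hp : 1 ≤ p) (k : ℕ) {f : I → ℂ}
    (hf : AEStronglyMeasurable f μ) :
    P.levelNorm p (fun R => ⨍ y in R, f y ∂μ) k ≤
      eLpNorm f (ENNReal.ofReal p) (P.normalized k) := by
  have hp0 : 0 < p := by linarith
  rw [eLpNorm_ofReal_eq hp0, normalized, P.lintegral_weighted, levelNorm]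
  gcongr with R hR
  exact P.enorm_setAverage_rpow_le hp hR hf

omit [IsFiniteMeasure μ] in
-- Since cells of one level are disjoint, the `p`-th power of the norm splits over cells; `C` bounds
-- the norm of a single atom in `L^p(ν)`.
theorem eLpNorm_block_le {s p : ℝ} (hp : 1 ≤ p) {c : Set I → ℂ} {a : Set I → I → ℂ} {j : ℕ}
    (ha : ∀ Q ∈ P.cells j, IsSouzaAtom μ s p Q (a Q)) {ν : Measure I} (hν : ν ≪ μ) {C : ℝ≥0∞}
    (hC : ∀ Q ∈ P.cells j, ENNReal.ofReal (μ.real Q ^ (s - 1 / p)) ^ p * ν Q ≤ C ^ p) :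
    eLpNorm (P.block c a j) (ENNReal.ofReal p) ν ≤ C * P.levelNorm p c j := by
  have hp0 : 0 < p := by linarith
  rw [eLpNorm_ofReal_eq hp0, levelNorm, ← finset_Lp_const_mul _ _ _ hp0]
  gcongr
  calc ∫⁻ x, ‖P.block c a j x‖ₑ ^ p ∂ν
      ≤ ∫⁻ x, ∑ Q ∈ P.cells j, Q.indicator
          (fun _ => (‖c Q‖ₑ * ENNReal.ofReal (μ.real Q ^ (s - 1 / p))) ^ p) x ∂ν := by
        refine lintegral_mono_ae ?_
        filter_upwards [hν.ae_le (hP.ae_mem_cell j)] with x ⟨R, hR, hx⟩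
        rw [hP.sum_eq_of_mem hR hx (fun Q => Q.indicator
          (fun _ => (‖c Q‖ₑ * ENNReal.ofReal (μ.real Q ^ (s - 1 / p))) ^ p) x)
          fun Q _ h => Set.indicator_of_notMem h _, Set.indicator_of_mem hx,
          hP.block_of_mem hR hx ha, enorm_mul]
        gcongr
        rw [← ofReal_norm]
        exact ENNReal.ofReal_le_ofReal ((ha R hR).2.2 x)
    _ = ∑ Q ∈ P.cells j, (‖c Q‖ₑ * ENNReal.ofReal (μ.real Q ^ (s - 1 / p))) ^ p * ν Q := by
        rw [lintegral_finsetSum' _ fun R hR =>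
          (measurable_const.indicator (P.measurable_cells j R hR)).aemeasurable]
        exact Finset.sum_congr rfl fun R hR => lintegral_indicator_const (P.measurable_cells j R hR) _
    _ ≤ _ := by
        refine Finset.sum_le_sum fun Q hQ => ?_
        rw [ENNReal.mul_rpow_of_nonneg _ _ hp0.le, ENNReal.mul_rpow_of_nonneg _ _ hp0.le, mul_assoc,
          mul_comm (C ^ p)]
        gcongr
        exact hC Q hQ

/-- If `R` is the ancestor of `Q` at level `j`, the left side is `|Q| / |R|`. -/
theorem normalized_apply_le {j k : ℕ} (hjk : j ≤ k) {Q : Set I} (hQ : Q ∈ P.cells k) :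
    P.normalized j Q ≤ ENNReal.ofReal (l₂ ^ (k - j)) := by
  obtain ⟨R, hR, hQR⟩ := hP.exists_ancestor hjk hQ
  have h1 : P.normalized j Q = (μ R)⁻¹ * μ Q := by
    rw [normalized, P.weighted_apply _ j (P.measurable_cells k Q hQ),
      setLIntegral_congr_fun (g := fun _ => (μ R)⁻¹) (P.measurable_cells k Q hQ) ?_,
      setLIntegral_const]
    intro x hx
    dsimp only
    rw [hP.sum_eq_of_mem hR (hQR hx) (fun R => R.indicator (fun _ => (μ R)⁻¹) x)
      fun Q _ h => Set.indicator_of_notMem h _, Set.indicator_of_mem (hQR hx)]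
  have hR0 := P.measureReal_pos hR
  rw [h1, ← ofReal_measureReal (μ := μ) (s := R), ← ofReal_measureReal (μ := μ) (s := Q),
    ← ENNReal.ofReal_inv_of_pos hR0, ← ENNReal.ofReal_mul (by positivity)]
  apply ENNReal.ofReal_le_ofReal
  rw [inv_mul_le_iff₀ hR0, mul_comm]
  exact hP.measureReal_le_mul_of_subset hjk hQ hR hQR

omit hP in
theorem _root_.Grid.memLp_block (P : Grid μ) {s p : ℝ} {c : Set I → ℂ} {a : Set I → I → ℂ} {j : ℕ}
    (ha : ∀ Q ∈ P.cells j, IsSouzaAtom μ s p Q (a Q)) (r : ℝ≥0∞) : MemLp (P.block c a j) r μ := by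
  refine memLp_finsetSum _ fun Q hQ => MemLp.const_mul ?_ _
  obtain ⟨h1, ⟨z, hz⟩, -⟩ := ha Q hQ
  have : a Q = Q.indicator (fun _ => z) := by
    ext x
    by_cases hx : x ∈ Q
    · simp [hx, hz x hx]
    · simp [hx, h1 x hx]
  rw [this]
  exact memLp_indicator_const _ (P.measurable_cells j Q hQ) _ (Or.inr (measure_ne_top _ _))

omit hP in
theorem _root_.Grid.memLp_cellMean (P : Grid μ) (k : ℕ) (f : I → ℂ) (r : ℝ≥0∞) :
    MemLp (P.cellMean k f) r μ :=
  memLp_finsetSum _ fun Q hQ =>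
    memLp_indicator_const _ (P.measurable_cells k Q hQ) _ (Or.inr (measure_ne_top _ _))

theorem cellMean_sub_of_isStep {k : ℕ} {f h : I → ℂ} (hf : Integrable f μ) (hi : Integrable h μ)
    (hh : P.IsStep k h) {R : Set I} (hR : R ∈ P.cells k) {x : I} (hx : x ∈ R) :
    P.cellMean k (f - h) x = P.cellMean k f x - h x := by
  rw [hP.cellMean_of_mem hR hx, hP.cellMean_of_mem hR hx, ← P.setAverage_of_isStep hh hR hx]
  simp only [setAverage_eq, Pi.sub_apply]
  rw [integral_sub hf.restrict hi.restrict, smul_sub]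

end IsGood
end Grid
end

/-! ### Oscillation of `g` and jumps of its means. -/

noncomputable section

namespace Grid

variable {I : Type*} [MeasurableSpace I] {μ : Measure I}

theorem IsStep.sum {P : Grid μ} {k : ℕ} {ι : Type*} {t : Finset ι} {h : ι → I → ℂ}
    (hh : ∀ i ∈ t, P.IsStep k (h i)) : P.IsStep k (fun x => ∑ i ∈ t, h i x) :=
  fun R hR x hx y hy => Finset.sum_congr rfl fun i hi => hh i hi R hR x hx y hy

/-- The partial sums of an atomic series. -/
def partialSum (P : Grid μ) (c : Set I → ℂ) (a : Set I → I → ℂ) (n : ℕ) (x : I) : ℂ :=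
  ∑ k ∈ Finset.range n, P.block c a k x

theorem partialSum_succ (P : Grid μ) (c : Set I → ℂ) (a : Set I → I → ℂ) (n : ℕ) (x : I) :
    P.partialSum c a (n + 1) x = P.partialSum c a n x + P.block c a n x :=
  Finset.sum_range_succ _ _

variable [IsFiniteMeasure μ]

theorem memLp_partialSum (P : Grid μ) {s p : ℝ} {c : Set I → ℂ} {a : Set I → I → ℂ}
    (ha : ∀ k, ∀ Q ∈ P.cells k, IsSouzaAtom μ s p Q (a Q)) (n : ℕ) (r : ℝ≥0∞) :
    MemLp (P.partialSum c a n) r μ :=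
  memLp_finsetSum _ fun k _ => P.memLp_block (ha k) r

namespace IsGood

variable {P : Grid μ} {l₁ l₂ : ℝ} (hP : P.IsGood l₁ l₂)
include hP

omit [IsFiniteMeasure μ] in
theorem isStep_partialSum {s p : ℝ} {c : Set I → ℂ} {a : Set I → I → ℂ}
    (ha : ∀ k, ∀ Q ∈ P.cells k, IsSouzaAtom μ s p Q (a Q)) {n k : ℕ} (hnk : n ≤ k + 1) :
    P.IsStep k (P.partialSum c a n) :=
  IsStep.sum fun j hj => hP.isStep_mono (by have := Finset.mem_range.1 hj; omega)
    (hP.isStep_block (ha j))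

/-- For smoothness `1/p` the atoms are bounded by `1`, so only the mass of a cell of level `k` under
`normalized j` matters. -/
theorem eLpNorm_block_normalized_le {p : ℝ} (hp : 1 ≤ p) {c : Set I → ℂ} {a : Set I → I → ℂ}
    {j k : ℕ} (hjk : j ≤ k) (ha : ∀ Q ∈ P.cells k, IsSouzaAtom μ (1 / p) p Q (a Q)) :
    eLpNorm (P.block c a k) (ENNReal.ofReal p) (P.normalized j) ≤
      ENNReal.ofReal (l₂ ^ (1 / p)) ^ (k - j) * P.levelNorm p c k := by
  have hp0 : 0 < p := by linarith
  have hl := hP.l₂_pos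
  refine hP.eLpNorm_block_le hp ha (P.normalized_absolutelyContinuous j) fun Q hQ => ?_
  rw [sub_self, Real.rpow_zero, ENNReal.ofReal_one, ENNReal.one_rpow, one_mul]
  refine (hP.normalized_apply_le hjk hQ).trans (le_of_eq ?_)
  rw [← ENNReal.ofReal_pow (by positivity), ENNReal.ofReal_rpow_of_nonneg (by positivity) hp0.le]
  congr 1
  rw [← Real.rpow_natCast, ← Real.rpow_natCast (l₂ ^ (1 / p)), ← Real.rpow_mul hl.le,
    ← Real.rpow_mul hl.le]
  congr 1
  field_simp

/-- The blocks from level `k` on are summed as a geometric series. -/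
theorem eLpNorm_sub_partialSum_normalized_le {p : ℝ} (hp : 1 ≤ p) {g : I → ℂ}
    (hg : MemLp g (ENNReal.ofReal p) μ) {c : Set I → ℂ} {a : Set I → I → ℂ}
    (hr : P.IsRepresentation (1 / p) p ∞ g c a) (k : ℕ) :
    eLpNorm (g - P.partialSum c a k) (ENNReal.ofReal p) (P.normalized k) ≤
      (1 - ENNReal.ofReal (l₂ ^ (1 / p)))⁻¹ * P.cost p ∞ c := by
  have hp0 : 0 < p := by linarith
  have hp1 : 1 ≤ ENNReal.ofReal p := by simpa using hp
  set θ := ENNReal.ofReal (l₂ ^ (1 / p))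
  set N := P.cost p ∞ c with hN
  have hac := P.normalized_absolutelyContinuous k
  -- A crude constant with `normalized k ≤ C • μ`. It depends on `k`, but only multiplies a
  -- remainder that tends to zero in `L^p(μ)`.
  set C := ∑ R ∈ P.cells k, (μ R)⁻¹ with hC
  have hCtop : C ≠ ∞ :=
    ENNReal.sum_ne_top.2 fun R hR => ENNReal.inv_ne_top.2 (P.measure_pos k R hR).ne'
  have hC0 : C ≠ 0 := by
    intro h0
    have h1 := P.weighted_le_smul (fun R => (μ R)⁻¹) k
    rw [← hC, h0, zero_smul] at h1
    have h2 : μ Set.univ = 0 := by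
      have h3 : ∀ R ∈ P.cells k, (μ R)⁻¹ = 0 := fun R hR => by
        rw [hC] at h0
        exact Finset.sum_eq_zero_iff.1 h0 R hR
      by_contra hne
      have : (ae μ).NeBot := ae_neBot.2 fun h => hne (by simp [h])
      obtain ⟨x, R, hR, -⟩ := (hP.ae_mem_cell k).exists
      exact absurd (h3 R hR) (ENNReal.inv_ne_zero.2 (measure_ne_top _ _))
    have h3 := P.measure_pos 0 Set.univ (by simp [hP.zero_level])
    exact h3.ne' h2
  have hm : ∀ n, AEStronglyMeasurable (P.partialSum c a n) μ := fun n =>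
    (P.memLp_partialSum hr.atoms n 1).1
  have htail : ∀ n, eLpNorm (g - P.partialSum c a n) (ENNReal.ofReal p) (P.normalized k) ≤
      C ^ (1 / ENNReal.ofReal p).toReal *
        eLpNorm (g - P.partialSum c a n) (ENNReal.ofReal p) μ := fun n => by
    rw [← smul_eq_mul, ← eLpNorm_smul_measure_of_ne_zero hC0]
    exact eLpNorm_mono_measure _ (P.weighted_le_smul _ k)
  have hbound : ∀ n, k ≤ n →
      eLpNorm (P.partialSum c a n - P.partialSum c a k) (ENNReal.ofReal p) (P.normalized k) ≤
        (∑ j ∈ Finset.range (n - k), θ ^ j) * N := by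
    intro n hn
    induction n, hn using Nat.le_induction with
    | base => simp
    | succ n hn ih =>
      have : P.partialSum c a (n + 1) - P.partialSum c a k =
          (P.partialSum c a n - P.partialSum c a k) + P.block c a n := by
        ext x
        simp only [Pi.sub_apply, Pi.add_apply, partialSum_succ]
        ring
      rw [this, Nat.succ_sub hn, Finset.sum_range_succ, add_mul]
      refine (eLpNorm_add_le (((hm n).sub (hm k)).mono_ac hac)
        ((P.memLp_block (hr.atoms n) 1).1.mono_ac hac) hp1).trans ?_
      refine add_le_add ih ((hP.eLpNorm_block_normalized_le hp hn (hr.atoms n)).trans ?_)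
      gcongr
      rw [hN, cost_eq_seqNorm]
      exact le_seqNorm le_top _ n
  have hlim : Tendsto (fun n => (1 - θ)⁻¹ * N + C ^ (1 / ENNReal.ofReal p).toReal *
      eLpNorm (g - P.partialSum c a n) (ENNReal.ofReal p) μ) atTop (𝓝 ((1 - θ)⁻¹ * N)) := by
    have h1 : Tendsto (fun n => eLpNorm (g - P.partialSum c a n) (ENNReal.ofReal p) μ)
      atTop (𝓝 0) := hr.tendsto
    have h2 := ENNReal.Tendsto.const_mul (a := C ^ (1 / ENNReal.ofReal p).toReal) h1
      (Or.inr (ENNReal.rpow_ne_top_of_nonneg ENNReal.toReal_nonneg hCtop))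
    simpa using h2.const_add ((1 - θ)⁻¹ * N)
  refine ge_of_tendsto hlim ?_
  filter_upwards [eventually_ge_atTop k] with n hn
  have : g - P.partialSum c a k =
      (P.partialSum c a n - P.partialSum c a k) + (g - P.partialSum c a n) := by
    ext x
    simp only [Pi.sub_apply, Pi.add_apply]
    ring
  rw [this]
  refine (eLpNorm_add_le (((hm n).sub (hm k)).mono_ac hac)
    ((hg.1.sub (hm n)).mono_ac hac) hp1).trans (add_le_add ((hbound n hn).trans ?_) (htail n))
  gcongr
  rw [← ENNReal.tsum_geometric]
  exact ENNReal.sum_le_tsum _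

/-- The `ℓ^p` norm of the jumps of the means of `g` from one level to the next is bounded by the
norm of `g` in `B^{1/p}_{p,∞}`. -/
theorem levelNorm_jump_le {p : ℝ} (hp : 1 ≤ p) {g : I → ℂ}
    (hg : MemLp g (ENNReal.ofReal p) μ) {c : Set I → ℂ} {a : Set I → I → ℂ}
    (hr : P.IsRepresentation (1 / p) p ∞ g c a) (k : ℕ) :
    P.levelNorm p (fun R => ⨍ y in R, (P.cellMean (k + 1) g - P.cellMean k g) y ∂μ) (k + 1) ≤
      (1 + ENNReal.ofReal l₁⁻¹ ^ (1 / p)) * ((1 - ENNReal.ofReal (l₂ ^ (1 / p)))⁻¹ *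
        P.cost p ∞ c) := by
  have hp0 : 0 < p := by linarith
  have hp1 : 1 ≤ ENNReal.ofReal p := by simpa using hp
  set T := (1 - ENNReal.ofReal (l₂ ^ (1 / p)))⁻¹ * P.cost p ∞ c
  have hac := P.normalized_absolutelyContinuous (k + 1)
  have hm := P.memLp_partialSum hr.atoms (k + 1) 1 (c := c)
  set u := g - P.partialSum c a (k + 1)
  have hgi : Integrable g μ := hg.integrable hp1
  have hui : Integrable u μ := hgi.sub (memLp_one_iff_integrable.1 hm)
  have hu : eLpNorm u (ENNReal.ofReal p) (P.normalized (k + 1)) ≤ T :=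
    hP.eLpNorm_sub_partialSum_normalized_le hp hg hr (k + 1)
  have hmean : ∀ j, AEStronglyMeasurable (P.cellMean j u) μ := fun j => (P.memLp_cellMean j u 1).1
  -- The partial sum with `k + 1` terms stops at level `k`, so both means reproduce it and it
  -- cancels in the jump.
  have heq : P.cellMean (k + 1) g - P.cellMean k g =ᵐ[P.normalized (k + 1)]
      P.cellMean (k + 1) u - P.cellMean k u := by
    refine hac.ae_le ?_
    filter_upwards [hP.ae_mem_cell (k + 1)] with x ⟨R, hR, hx⟩
    obtain ⟨Q, hQ, hRQ⟩ := hP.nested k R hR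
    simp only [Pi.sub_apply]
    rw [hP.cellMean_sub_of_isStep hgi (memLp_one_iff_integrable.1 hm)
        (hP.isStep_partialSum hr.atoms (by omega)) hR hx,
      hP.cellMean_sub_of_isStep hgi (memLp_one_iff_integrable.1 hm)
        (hP.isStep_partialSum hr.atoms le_rfl) hQ (hRQ hx)]
    ring
  have hl : ENNReal.ofReal l₁⁻¹ ≠ 0 := by simpa using hP.pos
  have h1p : (1 / ENNReal.ofReal p).toReal = 1 / p := by
    simp [ENNReal.toReal_inv, ENNReal.toReal_ofReal hp0.le]
  refine (P.levelNorm_setAverage_le hp (k + 1) ((P.memLp_cellMean _ g 1).1.sub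
    (P.memLp_cellMean _ g 1).1)).trans ?_
  rw [eLpNorm_congr_ae heq, add_mul, one_mul]
  refine (eLpNorm_sub_le ((hmean _).mono_ac hac) ((hmean _).mono_ac hac) hp1).trans
    (add_le_add ((hP.eLpNorm_cellMean_le hp _ _ hui.1).trans hu) ?_)
  -- The mean of level `k` contracts the norm for `normalized k`; passing to that measure costs
  -- `l₁^(-1/p)`, and returning costs nothing.
  calc eLpNorm (P.cellMean k u) (ENNReal.ofReal p) (P.normalized (k + 1))
      ≤ eLpNorm (P.cellMean k u) (ENNReal.ofReal p) (ENNReal.ofReal l₁⁻¹ • P.normalized k) :=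
        eLpNorm_mono_measure _ (hP.normalized_succ_le k)
    _ = ENNReal.ofReal l₁⁻¹ ^ (1 / p) *
        eLpNorm (P.cellMean k u) (ENNReal.ofReal p) (P.normalized k) := by
        rw [eLpNorm_smul_measure_of_ne_zero hl, h1p, smul_eq_mul]
    _ ≤ _ := by
        gcongr
        exact (hP.eLpNorm_cellMean_le hp _ _ hui.1).trans
          ((eLpNorm_mono_measure _ (hP.normalized_le_succ k)).trans hu)

/-- The mean of level `n` fixes the `n`-th partial sum and contracts `L^p`, so the error is at most
twice that of the partial sum. -/
theorem tendsto_eLpNorm_cellMean_sub {s p : ℝ} {q : ℝ≥0∞} (hp : 1 ≤ p) {g : I → ℂ}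
    (hg : MemLp g (ENNReal.ofReal p) μ) {c : Set I → ℂ} {a : Set I → I → ℂ}
    (hr : P.IsRepresentation s p q g c a) :
    Tendsto (fun n => eLpNorm (P.cellMean n g - g) (ENNReal.ofReal p) μ) atTop (𝓝 0) := by
  have hp1 : 1 ≤ ENNReal.ofReal p := by simpa using hp
  have hgi : Integrable g μ := hg.integrable hp1
  have hlim : Tendsto (fun n => 2 * eLpNorm (g - P.partialSum c a n) (ENNReal.ofReal p) μ)
      atTop (𝓝 0) := by
    have h1 : Tendsto (fun n => eLpNorm (g - P.partialSum c a n) (ENNReal.ofReal p) μ)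
      atTop (𝓝 0) := hr.tendsto
    simpa using ENNReal.Tendsto.const_mul (a := 2) h1 (Or.inr (by simp))
  refine tendsto_of_tendsto_of_tendsto_of_le_of_le tendsto_const_nhds hlim (fun _ => zero_le)
    fun n => ?_
  have hm := memLp_one_iff_integrable.1 (P.memLp_partialSum hr.atoms n 1 (c := c))
  set u := g - P.partialSum c a n with hu
  have hui : Integrable u μ := hgi.sub hm
  have heq : P.cellMean n g - g =ᵐ[μ] P.cellMean n u - u := by
    filter_upwards [hP.ae_mem_cell n] with x ⟨R, hR, hx⟩
    simp only [Pi.sub_apply, hu]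
    rw [hP.cellMean_sub_of_isStep hgi hm (hP.isStep_partialSum hr.atoms (by omega)) hR hx]
    ring
  dsimp only
  rw [eLpNorm_congr_ae heq, two_mul]
  refine (eLpNorm_sub_le (P.memLp_cellMean n u 1).1 hui.1 hp1).trans (add_le_add ?_ le_rfl)
  have := hP.eLpNorm_cellMean_le hp (fun _ => 1) n hui.1
  rwa [hP.weighted_one] at this

end IsGood
end Grid
end

/-! ### Convergence of products, and atomic series built from step functions. -/

noncomputable section

/-- Approximating `f` by a bounded `F m` lets the uniform bound on `u n` handle `f - F m`, while the
decay of `u n` in `L^r` handles `F m`. -/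
theorem tendsto_eLpNorm_mul_zero {α : Type*} [MeasurableSpace α] {ν : Measure α} {r : ℝ≥0∞}
    (hr : 1 ≤ r) {u F : ℕ → α → ℂ} {f : α → ℂ} {C : ℝ≥0∞} (hC : C ≠ ∞)
    (hum : ∀ n, AEStronglyMeasurable (u n) ν) (hf : AEStronglyMeasurable f ν)
    (hu : ∀ n, eLpNorm (u n) ∞ ν ≤ C) (hu0 : Tendsto (fun n => eLpNorm (u n) r ν) atTop (𝓝 0))
    (hF : ∀ n, MemLp (F n) ∞ ν) (hFf : Tendsto (fun n => eLpNorm (f - F n) r ν) atTop (𝓝 0)) :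
    Tendsto (fun n => eLpNorm (u n * f) r ν) atTop (𝓝 0) := by
  rw [ENNReal.tendsto_nhds_zero]
  intro ε hε
  have hε2 : 0 < ε / 2 := ENNReal.half_pos hε.ne'
  have h1 : Tendsto (fun n => C * eLpNorm (f - F n) r ν) atTop (𝓝 0) := by
    simpa using ENNReal.Tendsto.const_mul (a := C) hFf (Or.inr hC)
  obtain ⟨m, hm⟩ := (ENNReal.tendsto_nhds_zero.1 h1 (ε / 2) hε2).exists
  have h2 : Tendsto (fun n => eLpNorm (u n) r ν * eLpNorm (F m) ∞ ν) atTop (𝓝 0) := by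
    simpa using ENNReal.Tendsto.mul_const (b := eLpNorm (F m) ∞ ν) hu0 (Or.inr (hF m).2.ne)
  filter_upwards [ENNReal.tendsto_nhds_zero.1 h2 (ε / 2) hε2] with n hn
  have : u n * f = u n • (f - F m) + u n • F m := by
    ext x
    simp only [Pi.mul_apply, Pi.add_apply, Pi.sub_apply, smul_eq_mul]
    ring
  rw [this]
  refine (eLpNorm_add_le ((hum n).smul (hf.sub (hF m).1)) ((hum n).smul (hF m).1) hr).trans ?_
  rw [← ENNReal.add_halves ε]
  refine add_le_add ?_ ?_
  · refine (eLpNorm_smul_le_eLpNorm_top_mul_eLpNorm r (hf.sub (hF m).1) (u n)).trans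
      (le_trans ?_ hm)
    gcongr
    exact hu n
  · exact (eLpNorm_smul_le_eLpNorm_mul_eLpNorm_top r (F m) (hum n)).trans hn

namespace Grid

variable {I : Type*} [MeasurableSpace I] {μ : Measure I}

/-- The level of a cell. -/
def level (P : Grid μ) (R : Set I) : ℕ := sInf {k | R ∈ P.cells k}

theorem level_eq (P : Grid μ) {k : ℕ} {R : Set I} (hR : R ∈ P.cells k) : P.level R = k := by
  have h : R ∈ P.cells (P.level R) := Nat.sInf_mem (s := {k | R ∈ P.cells k}) ⟨k, hR⟩
  by_contra hne
  exact P.level_ne _ _ hne R h R hR rfl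

/-- The coefficients of the atomic series with blocks `h k`. -/
def stepCoeff (P : Grid μ) (s p : ℝ) (h : ℕ → I → ℂ) (R : Set I) : ℂ :=
  (⨍ y in R, h (P.level R) y ∂μ) * ((μ.real R ^ (1 / p - s) : ℝ) : ℂ)

variable (μ) in
/-- The canonical Souza's atom on `R`. -/
def canonicalAtom (s p : ℝ) (R : Set I) : I → ℂ :=
  R.indicator fun _ => ((μ.real R ^ (s - 1 / p) : ℝ) : ℂ)

theorem isSouzaAtom_canonicalAtom (s p : ℝ) (R : Set I) :
    IsSouzaAtom μ s p R (canonicalAtom μ s p R) := by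
  have h0 : 0 ≤ μ.real R ^ (s - 1 / p) := Real.rpow_nonneg measureReal_nonneg _
  refine ⟨fun x hx => Set.indicator_of_notMem hx _, ⟨_, fun x hx => Set.indicator_of_mem hx _⟩,
    fun x => ?_⟩
  by_cases hx : x ∈ R
  · rw [canonicalAtom, Set.indicator_of_mem hx, Complex.norm_real, Real.norm_of_nonneg h0]
  · rw [canonicalAtom, Set.indicator_of_notMem hx, norm_zero]
    exact h0

variable [IsFiniteMeasure μ]

theorem block_stepCoeff (P : Grid μ) (s p : ℝ) (h : ℕ → I → ℂ) (k : ℕ) :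
    P.block (P.stepCoeff s p h) (canonicalAtom μ s p) k = P.cellMean k (h k) := by
  ext x
  refine Finset.sum_congr rfl fun R hR => ?_
  by_cases hx : x ∈ R
  · rw [canonicalAtom, Set.indicator_of_mem hx, Set.indicator_of_mem hx, stepCoeff, P.level_eq hR,
      mul_assoc, ← Complex.ofReal_mul, ← Real.rpow_add (P.measureReal_pos hR)]
    simp
  · rw [canonicalAtom, Set.indicator_of_notMem hx, Set.indicator_of_notMem hx, mul_zero]

theorem enorm_setAverage_le (P : Grid μ) {k : ℕ} {R : Set I} (hR : R ∈ P.cells k) {f : I → ℂ}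
    (hf : AEStronglyMeasurable f μ) : ‖⨍ y in R, f y ∂μ‖ₑ ≤ eLpNorm f ∞ μ := by
  have h := P.enorm_setAverage_rpow_le le_rfl hR hf
  simp only [ENNReal.rpow_one] at h
  refine h.trans ?_
  calc (μ R)⁻¹ * ∫⁻ y in R, ‖f y‖ₑ ∂μ ≤ (μ R)⁻¹ * ∫⁻ _ in R, eLpNorm f ∞ μ ∂μ := by
        gcongr 1
        refine lintegral_mono_ae (ae_restrict_of_ae ?_)
        rw [eLpNorm_exponent_top]
        exact ae_le_eLpNormEssSup
    _ = eLpNorm f ∞ μ := by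
        rw [setLIntegral_const, mul_comm, mul_assoc,
          ENNReal.mul_inv_cancel (P.measure_pos k R hR).ne' (measure_ne_top _ _), mul_one]

namespace IsGood

variable {P : Grid μ} {l₁ l₂ : ℝ} (hP : P.IsGood l₁ l₂)
include hP

/-- An atom on `Q` has `L^p` norm at most `|Q|^s`, which decays like `l₂^(s k)`; finite cost and `s
> 0` thus force absolute convergence. -/
theorem tsum_eLpNorm_block_lt_top {s p : ℝ} {q : ℝ≥0∞} (hp : 1 ≤ p) (hq : 1 ≤ q) (hs : 0 < s)
    {c : Set I → ℂ} {a : Set I → I → ℂ} (ha : ∀ k, ∀ Q ∈ P.cells k, IsSouzaAtom μ s p Q (a Q))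
    (hc : P.cost p q c < ∞) : ∑' k, eLpNorm (P.block c a k) (ENNReal.ofReal p) μ < ∞ := by
  have hp0 : 0 < p := by linarith
  have hl := hP.l₂_pos
  set m := μ.real Set.univ
  have hm : 0 ≤ m := measureReal_nonneg
  have h1 : ∀ k, eLpNorm (P.block c a k) (ENNReal.ofReal p) μ ≤
      ENNReal.ofReal (m ^ s) * P.cost p q c * ENNReal.ofReal (l₂ ^ s) ^ k := fun k => by
    have h2 : P.levelNorm p c k ≤ P.cost p q c := by
      rw [cost_eq_seqNorm]
      exact le_seqNorm hq _ k
    have h3 := hP.eLpNorm_block_le (c := c) (C := ENNReal.ofReal ((l₂ ^ k * m) ^ s)) hp (ha k)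
      Measure.AbsolutelyContinuous.rfl fun Q hQ => by
        have hQ0 := P.measureReal_pos hQ
        have hQ1 : μ.real Q ≤ l₂ ^ k * m := by
          simpa using hP.measureReal_le_mul_of_subset (Nat.zero_le k) hQ
            (show Set.univ ∈ P.cells 0 by simp [hP.zero_level]) (Set.subset_univ _)
        rw [← ofReal_measureReal (μ := μ) (s := Q),
          ENNReal.ofReal_rpow_of_nonneg (by positivity) hp0.le,
          ENNReal.ofReal_rpow_of_nonneg (by positivity) hp0.le,
          ← ENNReal.ofReal_mul (by positivity)]
        apply ENNReal.ofReal_le_ofReal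
        calc (μ.real Q ^ (s - 1 / p)) ^ p * μ.real Q = (μ.real Q ^ s) ^ p := by
              rw [← Real.rpow_mul hQ0.le, ← Real.rpow_mul hQ0.le, ← Real.rpow_add_one hQ0.ne']
              congr 1
              field_simp
              ring
          _ ≤ _ := by gcongr
    refine h3.trans ?_
    have h4 : (l₂ ^ k * m) ^ s = (l₂ ^ s) ^ k * m ^ s := by
      rw [Real.mul_rpow (by positivity) hm, ← Real.rpow_natCast, ← Real.rpow_mul hl.le,
        mul_comm (k : ℝ), Real.rpow_mul hl.le, Real.rpow_natCast]
    rw [h4, ENNReal.ofReal_mul (by positivity), ENNReal.ofReal_pow (by positivity)]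
    calc _ ≤ ENNReal.ofReal (l₂ ^ s) ^ k * ENNReal.ofReal (m ^ s) * P.cost p q c := by gcongr
      _ = _ := by ring
  refine (ENNReal.tsum_le_tsum h1).trans_lt ?_
  rw [ENNReal.tsum_mul_left, ENNReal.tsum_geometric]
  refine ENNReal.mul_lt_top (ENNReal.mul_lt_top ENNReal.ofReal_lt_top hc) ?_
  rw [ENNReal.inv_lt_top, tsub_pos_iff_lt, ENNReal.ofReal_lt_one]
  exact Real.rpow_lt_one hl.le hP.lt_one hs

theorem isRepresentation_of_isStep {s p : ℝ} {q : ℝ≥0∞} (hp : 1 ≤ p) (hq : 1 ≤ q) (hs : 0 < s)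
    {f : I → ℂ} {h : ℕ → I → ℂ} (hh : ∀ k, P.IsStep k (h k))
    (hc : P.cost p q (P.stepCoeff s p h) < ∞)
    (hf : Tendsto (fun n : ℕ => eLpNorm (fun x => f x - ∑ k ∈ Finset.range n, h k x)
      (ENNReal.ofReal p) μ) atTop (𝓝 0)) :
    P.IsRepresentation s p q f (P.stepCoeff s p h) (canonicalAtom μ s p) := by
  refine ⟨fun _ Q _ => isSouzaAtom_canonicalAtom s p Q, hc,
    hP.tsum_eLpNorm_block_lt_top hp hq hs (fun _ Q _ => isSouzaAtom_canonicalAtom s p Q) hc, ?_⟩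
  refine hf.congr fun n => eLpNorm_congr_ae ?_
  filter_upwards [ae_all_iff.2 hP.ae_mem_cell] with x hx
  congr 1
  refine Finset.sum_congr rfl fun k _ => ?_
  obtain ⟨R, hR, hxR⟩ := hx k
  rw [P.block_stepCoeff, hP.cellMean_of_mem hR hxR, P.setAverage_of_isStep (hh k) hR hxR]

theorem tendsto_eLpNorm_mul_sub {s t p : ℝ} {q r : ℝ≥0∞} (hp : 1 ≤ p) {f g : I → ℂ}
    (hg : MemLp g (ENNReal.ofReal p) μ) (hgb : MemLp g ∞ μ) {e : Set I → ℂ} {b : Set I → I → ℂ}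
    (hrg : P.IsRepresentation t p r g e b)
    (hf : MemLp f (ENNReal.ofReal p) μ) {c : Set I → ℂ} {a : Set I → I → ℂ}
    (hr : P.IsRepresentation s p q f c a) :
    Tendsto (fun n => eLpNorm (fun x => g x * f x - P.cellMean (n - 1) g x * P.partialSum c a n x)
      (ENNReal.ofReal p) μ) atTop (𝓝 0) := by
  have hp1 : 1 ≤ ENNReal.ofReal p := by simpa using hp
  set G := eLpNorm g ∞ μ
  have hG : G ≠ ∞ := hgb.2.ne
  have hmean : ∀ n, AEStronglyMeasurable (P.cellMean n g) μ := fun n => (P.memLp_cellMean n g 1).1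
  have hsum : ∀ n r, MemLp (P.partialSum c a n) r μ := P.memLp_partialSum hr.atoms
  have hbd : ∀ n, eLpNorm (P.cellMean n g) ∞ μ ≤ G := fun n => by
    rw [eLpNorm_exponent_top]
    refine eLpNormEssSup_le_of_ae_enorm_bound ?_
    filter_upwards [hP.ae_mem_cell n] with x ⟨R, hR, hx⟩
    rw [hP.cellMean_of_mem hR hx]
    exact P.enorm_setAverage_le hR hgb.1
  have hFf : Tendsto (fun n => eLpNorm (f - P.partialSum c a n) (ENNReal.ofReal p) μ)
    atTop (𝓝 0) := hr.tendsto
  have h1 : Tendsto (fun n => G * eLpNorm (f - P.partialSum c a n) (ENNReal.ofReal p) μ)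
      atTop (𝓝 0) := by
    simpa using ENNReal.Tendsto.const_mul (a := G) hFf (Or.inr hG)
  have h2 : Tendsto (fun n => eLpNorm ((P.cellMean (n - 1) g - g) * f) (ENNReal.ofReal p) μ)
      atTop (𝓝 0) := by
    refine tendsto_eLpNorm_mul_zero hp1 (C := G + G) (by simp [hG])
      (fun n => (hmean _).sub hgb.1) hf.1 (fun n => ?_) ?_ (fun n => hsum n ∞) hFf
    · exact (eLpNorm_sub_le (hmean _) hgb.1 le_top).trans (add_le_add (hbd _) le_rfl)
    · exact (hP.tendsto_eLpNorm_cellMean_sub hp hg hrg).comp (tendsto_sub_atTop_nat 1)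
  refine tendsto_of_tendsto_of_tendsto_of_le_of_le tendsto_const_nhds
    (by simpa using h1.add h2) (fun _ => zero_le) fun n => ?_
  have : (fun x => g x * f x - P.cellMean (n - 1) g x * P.partialSum c a n x) =
      P.cellMean (n - 1) g • (f - P.partialSum c a n) - (P.cellMean (n - 1) g - g) * f := by
    ext x
    simp only [Pi.mul_apply, Pi.sub_apply, smul_eq_mul]
    ring
  dsimp only
  rw [this]
  refine (eLpNorm_sub_le ((hmean _).smul (hf.1.sub (hsum n 1).1))
    (((hmean _).sub hgb.1).mul hf.1) hp1).trans (add_le_add ?_ le_rfl)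
  refine (eLpNorm_smul_le_eLpNorm_top_mul_eLpNorm _ (hf.1.sub (hsum n 1).1) _).trans ?_
  gcongr
  exact hbd _

end IsGood
end Grid
end

/-! ### The atomic series of the product and its cost. -/

noncomputable section

/-- The solution of `x 0 = 0`, `x (k + 1) = θ (x k + b k)`. -/
def geometricConv (θ : ℝ≥0∞) (b : ℕ → ℝ≥0∞) : ℕ → ℝ≥0∞
  | 0 => 0
  | k + 1 => θ * (geometricConv θ b k + b k)

namespace Grid

variable {I : Type*} [MeasurableSpace I] {μ : Measure I} [IsFiniteMeasure μ]

namespace IsGood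

variable {P : Grid μ} {l₁ l₂ : ℝ} (hP : P.IsGood l₁ l₂)
include hP

/-- The weight exactly compensates the height of an atom on the cell, and each passage from a cell
to its child shrinks it by at least `l₂^(1/p-s)`. -/
theorem enorm_partialSum_mul_le {s p : ℝ} (hp : 1 ≤ p) (hsp : s ≤ 1 / p) {c : Set I → ℂ}
    {a : Set I → I → ℂ} (ha : ∀ k, ∀ Q ∈ P.cells k, IsSouzaAtom μ s p Q (a Q)) (k : ℕ)
    {R : Set I} (hR : R ∈ P.cells k) {x : I} (hx : x ∈ R) :
    ‖P.partialSum c a k x‖ₑ * ENNReal.ofReal (μ.real R ^ (1 / p - s)) ≤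
      geometricConv (ENNReal.ofReal (l₂ ^ (1 / p - s))) (P.levelNorm p c) k := by
  have hp0 : 0 < p := by linarith
  induction k generalizing R with
  | zero => simp [partialSum]
  | succ k ih =>
    obtain ⟨Q, hQ, hRQ⟩ := hP.nested k R hR
    have hQ0 := P.measureReal_pos hQ
    have hl := hP.l₂_pos
    have hmul : ENNReal.ofReal (μ.real R ^ (1 / p - s)) ≤
        ENNReal.ofReal (l₂ ^ (1 / p - s)) * ENNReal.ofReal (μ.real Q ^ (1 / p - s)) := by
      rw [← ENNReal.ofReal_mul (by positivity), ← Real.mul_rpow hl.le hQ0.le]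
      apply ENNReal.ofReal_le_ofReal
      have h1 := hP.measureReal_le_mul_of_subset (Nat.le_succ k) hR hQ hRQ
      refine Real.rpow_le_rpow measureReal_nonneg ?_ (by linarith)
      simpa using h1
    have hblock : ‖P.block c a k x‖ₑ * ENNReal.ofReal (μ.real Q ^ (1 / p - s)) ≤
        P.levelNorm p c k := by
      rw [hP.block_of_mem hQ (hRQ hx) (ha k), enorm_mul, mul_assoc]
      calc _ ≤ ‖c Q‖ₑ * (ENNReal.ofReal (μ.real Q ^ (s - 1 / p)) *
            ENNReal.ofReal (μ.real Q ^ (1 / p - s))) := by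
            gcongr
            rw [← ofReal_norm]
            exact ENNReal.ofReal_le_ofReal ((ha k Q hQ).2.2 x)
        _ = ‖c Q‖ₑ := by
            rw [← ENNReal.ofReal_mul (by positivity), ← Real.rpow_add hQ0]
            simp
        _ ≤ _ := P.enorm_le_levelNorm hp0 c hQ
    rw [partialSum_succ, geometricConv]
    calc _ ≤ (‖P.partialSum c a k x‖ₑ + ‖P.block c a k x‖ₑ) *
          (ENNReal.ofReal (l₂ ^ (1 / p - s)) * ENNReal.ofReal (μ.real Q ^ (1 / p - s))) := by
          gcongr
          exact enorm_add_le _ _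
      _ = ENNReal.ofReal (l₂ ^ (1 / p - s)) *
          (‖P.partialSum c a k x‖ₑ * ENNReal.ofReal (μ.real Q ^ (1 / p - s)) +
            ‖P.block c a k x‖ₑ * ENNReal.ofReal (μ.real Q ^ (1 / p - s))) := by ring
      _ ≤ _ := by
          gcongr
          exact ih hQ (hRQ hx)

theorem exists_isRepresentation_mul {s p : ℝ} {q : ℝ≥0∞} (hp : 1 ≤ p) (hq : 1 ≤ q) (hs : 0 < s)
    (hsp : s < 1 / p) {f g : I → ℂ} (hg : MemLp g (ENNReal.ofReal p) μ) (hgb : MemLp g ∞ μ)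
    {e : Set I → ℂ} {b : Set I → I → ℂ} (hrg : P.IsRepresentation (1 / p) p ∞ g e b)
    (hf : MemLp f (ENNReal.ofReal p) μ) {c : Set I → ℂ} {a : Set I → I → ℂ}
    (hr : P.IsRepresentation s p q f c a) {N : ℝ≥0∞} (hN : N ≠ ∞)
    (hjump : ∀ k, P.levelNorm p
      (fun R => ⨍ y in R, (P.cellMean (k + 1) g - P.cellMean k g) y ∂μ) (k + 1) ≤ N) :
    ∃ c' a', P.IsRepresentation s p q (fun x => g x * f x) c' a' ∧
      P.cost p q c' ≤
        (N * ENNReal.ofReal (1 - l₂ ^ (1 / p - s))⁻¹ + eLpNorm g ∞ μ) * P.cost p q c := by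
  have hp0 : 0 < p := by linarith
  have hl := hP.l₂_pos
  -- The mean is taken one index below because the `n`-th partial sum stops at level `n - 1`; thus
  -- `H (k + 1)` is constant on cells of level `k`.
  set H : ℕ → I → ℂ := fun n x => P.cellMean (n - 1) g x * P.partialSum c a n x with hH
  set h : ℕ → I → ℂ := fun k x => H (k + 1) x - H k x with hh
  set d : ℕ → I → ℂ := fun k => P.cellMean k g - P.cellMean (k - 1) g with hd
  set t := l₂ ^ (1 / p - s)
  have ht0 : 0 < t := by positivity
  have ht1 : t < 1 := Real.rpow_lt_one hl.le hP.lt_one (by linarith)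
  set X := geometricConv (ENNReal.ofReal t) (P.levelNorm p c) with hX
  have hh' : ∀ k x, h k x =
      P.cellMean k g x * P.block c a k x + d k x * P.partialSum c a k x := fun k x => by
    simp only [hh, hH, hd, Nat.add_sub_cancel, partialSum_succ, Pi.sub_apply]
    ring
  have hmstep : ∀ k, P.IsStep k (P.cellMean (k - 1) g) := fun k =>
    hP.isStep_mono (Nat.sub_le k 1) (hP.isStep_cellMean _ g)
  have hdstep : ∀ k, P.IsStep k (d k) := fun k R hR x hx y hy => by
    simp only [hd, Pi.sub_apply]
    rw [hP.isStep_cellMean k g R hR x hx y hy, hmstep k R hR x hx y hy]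
  have hstep : ∀ k, P.IsStep k (h k) := fun k R hR x hx y hy => by
    rw [hh', hh', hP.isStep_cellMean k g R hR x hx y hy, hdstep k R hR x hx y hy,
      hP.isStep_block (hr.atoms k) R hR x hx y hy,
      hP.isStep_partialSum hr.atoms (Nat.le_succ k) R hR x hx y hy]
  have hJ : ∀ k, P.levelNorm p (fun R => ⨍ y in R, d k y ∂μ) k ≤ N := fun k => by
    cases k with
    -- At level zero, truncated subtraction gives `0 - 1 = 0`, so the jump vanishes.
    | zero => simp [hd, levelNorm, hp0]
    | succ k => exact hjump k
  have hcoeff : ∀ k, ∀ R ∈ P.cells k, ‖P.stepCoeff s p h R‖ₑ ≤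
      eLpNorm g ∞ μ * ‖c R‖ₑ + X k * ‖⨍ y in R, d k y ∂μ‖ₑ := fun k R hR => by
    obtain ⟨x, hx⟩ := nonempty_of_measure_ne_zero (P.measure_pos k R hR).ne'
    have hR0 := P.measureReal_pos hR
    have hpow : ‖((μ.real R ^ (1 / p - s) : ℝ) : ℂ)‖ₑ =
        ENNReal.ofReal (μ.real R ^ (1 / p - s)) := by
      rw [← ofReal_norm, Complex.norm_real, Real.norm_of_nonneg (by positivity)]
    rw [stepCoeff, P.level_eq hR, P.setAverage_of_isStep (hstep k) hR hx,
      P.setAverage_of_isStep (hdstep k) hR hx, enorm_mul, hpow, hh']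
    have h1 : ‖P.cellMean k g x‖ₑ ≤ eLpNorm g ∞ μ := by
      rw [hP.cellMean_of_mem hR hx]
      exact P.enorm_setAverage_le hR hgb.1
    have h2 : ‖P.block c a k x‖ₑ * ENNReal.ofReal (μ.real R ^ (1 / p - s)) ≤ ‖c R‖ₑ := by
      rw [hP.block_of_mem hR hx (hr.atoms k), enorm_mul, mul_assoc]
      calc _ ≤ ‖c R‖ₑ * (ENNReal.ofReal (μ.real R ^ (s - 1 / p)) *
            ENNReal.ofReal (μ.real R ^ (1 / p - s))) := by
            gcongr
            rw [← ofReal_norm]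
            exact ENNReal.ofReal_le_ofReal ((hr.atoms k R hR).2.2 x)
        _ = ‖c R‖ₑ := by
            rw [← ENNReal.ofReal_mul (by positivity), ← Real.rpow_add hR0]
            simp
    calc _ ≤ (‖P.cellMean k g x‖ₑ * ‖P.block c a k x‖ₑ + ‖d k x‖ₑ * ‖P.partialSum c a k x‖ₑ) *
          ENNReal.ofReal (μ.real R ^ (1 / p - s)) := by
          gcongr
          rw [← enorm_mul, ← enorm_mul]
          exact enorm_add_le _ _
      _ = ‖P.cellMean k g x‖ₑ *
            (‖P.block c a k x‖ₑ * ENNReal.ofReal (μ.real R ^ (1 / p - s))) +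
          (‖P.partialSum c a k x‖ₑ * ENNReal.ofReal (μ.real R ^ (1 / p - s))) * ‖d k x‖ₑ := by
          ring
      _ ≤ _ := by
          gcongr
          exact hP.enorm_partialSum_mul_le hp hsp.le hr.atoms k hR hx
  have hlevel : ∀ k, P.levelNorm p (P.stepCoeff s p h) k ≤
      eLpNorm g ∞ μ * P.levelNorm p c k + N * X k := fun k => by
    refine (finset_Lp_le_of_le_add _ hp (hcoeff k)).trans (add_le_add le_rfl ?_)
    rw [mul_comm N]
    gcongr
    exact hJ k
  have hXnorm : seqNorm q X ≤ ENNReal.ofReal (1 - t)⁻¹ * P.cost p q c := by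
    rw [cost_eq_seqNorm]
    refine seqNorm_le_of_recurrence (θ := ENNReal.ofReal t) hq ?_ rfl (fun _ => rfl)
    have h1t : 0 < 1 - t := by linarith
    rw [← ENNReal.ofReal_one, ← ENNReal.ofReal_add (by positivity) zero_le_one,
      ← ENNReal.ofReal_mul ht0.le]
    apply ENNReal.ofReal_le_ofReal
    have h2 : (1 - t) * (1 - t)⁻¹ = 1 := mul_inv_cancel₀ h1t.ne'
    -- With the constant `(1 - t)⁻¹`, the required inequality reduces to `(1 - t)^2 ≥ 0`.
    nlinarith
  have hcost : P.cost p q (P.stepCoeff s p h) ≤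
      (N * ENNReal.ofReal (1 - t)⁻¹ + eLpNorm g ∞ μ) * P.cost p q c := by
    rw [cost_eq_seqNorm]
    refine (seqNorm_mono hlevel).trans ((seqNorm_add_le hq _ _).trans ?_)
    refine (add_le_add (seqNorm_const_mul_le hq _ _) (seqNorm_const_mul_le hq _ _)).trans ?_
    rw [← cost_eq_seqNorm, add_mul, add_comm, mul_assoc]
    gcongr
  refine ⟨_, _, hP.isRepresentation_of_isStep hp hq hs hstep (hcost.trans_lt ?_) ?_, hcost⟩
  · exact ENNReal.mul_lt_top (ENNReal.add_lt_top.2 ⟨ENNReal.mul_lt_top hN.lt_top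
      ENNReal.ofReal_lt_top, hgb.2⟩) hr.cost_lt_top
  · refine (hP.tendsto_eLpNorm_mul_sub hp hg hgb hrg hf hr).congr fun n => ?_
    congr 1
    ext x
    have : ∑ k ∈ Finset.range n, h k x = H n x - H 0 x :=
      Finset.sum_range_sub (fun n => H n x) n
    rw [this]
    -- `H 0` vanishes because its partial sum is empty.
    simp [hH, partialSum]

omit [IsFiniteMeasure μ] in
-- The last summand of `oscConst` alone bounds the second factor; `haarConst ≥ 1` and `l₁ < 1` make
-- `standardConst` dominate the first.
theorem jumpConst_le {p : ℝ} (hp : 1 ≤ p) :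
    (1 + ENNReal.ofReal l₁⁻¹ ^ (1 / p)) * (1 - ENNReal.ofReal (l₂ ^ (1 / p)))⁻¹ ≤
      ENNReal.ofReal (standardConst l₁ l₂ (1 / p) p * oscConst P l₂ (1 / p) p ∞) := by
  have hp0 : 0 < p := by linarith
  have hl₁ := hP.pos
  have hl := hP.l₂_pos
  have ht1 : l₂ ^ (1 / p) < 1 := Real.rpow_lt_one hl.le hP.lt_one (by positivity)
  have hmesh : ∀ k, 0 ≤ P.mesh k := fun k => Real.iSup_nonneg fun _ => measureReal_nonneg
  have hosc : (1 - l₂ ^ (1 / p))⁻¹ ≤ oscConst P l₂ (1 / p) p ∞ := by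
    have h1 : 0 ≤ holderConst p ∞ (fun k => P.mesh k ^ (1 / p * p)) := by
      simp only [holderConst, ENNReal.top_ne_one, if_false]
      exact Real.rpow_nonneg (tsum_nonneg fun k => Real.rpow_nonneg
        (Real.rpow_nonneg (hmesh k) _) _) _
    rw [oscConst, one_div (1 - _)]
    have : 0 ≤ (P.overlap : ℝ) ^ (1 + 1 / p) * holderConst p ∞ (fun k => P.mesh k ^ (1 / p * p)) *
      μ.real Set.univ ^ (-(1 / p)) :=
      mul_nonneg (mul_nonneg (by positivity) h1) (Real.rpow_nonneg measureReal_nonneg _)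
    linarith
  have hstd : 1 + l₁⁻¹ ^ (1 / p) ≤ standardConst l₁ l₂ (1 / p) p := by
    have h1 : 1 ≤ haarConst l₁ l₂ := by
      rw [haarConst]
      have : 0 ≤ l₂ ^ (1 / 2 : ℝ) / (√2 * l₁ ^ (3 / 2 : ℝ)) := by positivity
      linarith
    have h2 : l₁⁻¹ ^ (1 / p) ≤ l₁ ^ (-2 - 1 / p) := by
      rw [Real.inv_rpow hl₁.le, ← Real.rpow_neg hl₁.le]
      exact Real.rpow_le_rpow_of_exponent_ge hl₁ (hP.lt.trans hP.lt_one).le (by linarith)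
    have h3 : 0 ≤ l₁ ^ (-2 - 1 / p) := by positivity
    simp only [standardConst, sub_self, Real.rpow_zero, max_self, mul_one]
    nlinarith
  have h1t : 0 < 1 - l₂ ^ (1 / p) := by linarith
  rw [ENNReal.ofReal_rpow_of_nonneg (by positivity) (by positivity), ← ENNReal.ofReal_one,
    ← ENNReal.ofReal_add zero_le_one (by positivity), ← ENNReal.ofReal_sub _ (by positivity),
    ← ENNReal.ofReal_inv_of_pos h1t, ← ENNReal.ofReal_mul (by positivity)]
  apply ENNReal.ofReal_le_ofReal
  gcongr
  exact le_trans (by positivity) hstd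

end IsGood

/-! ### Infima over representations and the conclusion. -/

/-- The extended nonnegative version of `besovNorm`. -/
def besovENorm (P : Grid μ) (s p : ℝ) (q : ℝ≥0∞) (f : I → ℂ) : ℝ≥0∞ :=
  ⨅ (c : Set I → ℂ) (a : Set I → I → ℂ) (_ : P.IsRepresentation s p q f c a), P.cost p q c

omit [IsFiniteMeasure μ] in
theorem besovENorm_le (P : Grid μ) {s p : ℝ} {q : ℝ≥0∞} {f : I → ℂ} {c : Set I → ℂ}
    {a : Set I → I → ℂ} (h : P.IsRepresentation s p q f c a) :
    P.besovENorm s p q f ≤ P.cost p q c :=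
  iInf_le_of_le c (iInf_le_of_le a (iInf_le _ h))

omit [IsFiniteMeasure μ] in
theorem le_mul_besovENorm (P : Grid μ) {s p : ℝ} {q : ℝ≥0∞} {f : I → ℂ} {A C : ℝ≥0∞}
    (hC : C ≠ ∞) (hf : ∃ c a, P.IsRepresentation s p q f c a)
    (h : ∀ c a, P.IsRepresentation s p q f c a → A ≤ C * P.cost p q c) :
    A ≤ C * P.besovENorm s p q f := by
  by_cases hC0 : C = 0
  -- An actual representation is needed here: an empty infimum would be `∞`, and `0 * ∞ = 0`.
  · obtain ⟨c, a, hca⟩ := hf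
    simpa [hC0] using h c a hca
  · rw [← ENNReal.div_le_iff' hC0 hC]
    refine le_iInf fun c => le_iInf fun a => le_iInf fun hca => ?_
    rw [ENNReal.div_le_iff' hC0 hC]
    exact h c a hca

end Grid
end

theorem proposition16p6 {I : Type*} [MeasurableSpace I] (μ : Measure I) [IsFiniteMeasure μ]
    (P : Grid μ) (l₁ l₂ : ℝ) (hP : P.IsGood l₁ l₂)
    (s p : ℝ) (q : ℝ≥0∞) (hp : 1 ≤ p) (hq : 1 ≤ q) (hs : 0 < s) (hsp : s < 1 / p)
    (g : I → ℂ) (hg : P.MemBesov (1 / p) p ∞ g) (hg_bdd : MemLp g ∞ μ)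
    (K : ℝ) (hK : K = standardConst l₁ l₂ (1 / p) p * oscConst P l₂ (1 / p) p ∞ *
        (P.besovNorm (1 / p) p ∞ g / (1 - l₂ ^ (1 / p - s))) + (eLpNorm g ∞ μ).toReal) :
    (∀ f : I → ℂ, P.MemBesov s p q f →
      P.MemBesov s p q (fun x => g x * f x) ∧
        P.besovNorm s p q (fun x => g x * f x) ≤ K * P.besovNorm s p q f) ∧
      P.multiplierNorm s p q g ≤ K := by
  obtain ⟨hgp, e, b, hrg⟩ := hg
  have hl := hP.l₂_pos
  have ht1 : l₂ ^ (1 / p - s) < 1 := Real.rpow_lt_one hl.le hP.lt_one (by linarith)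
  have h1t : 0 < 1 - l₂ ^ (1 / p - s) := by linarith
  set A := standardConst l₁ l₂ (1 / p) p * oscConst P l₂ (1 / p) p ∞ with hA
  have hA1 := hP.jumpConst_le hp
  have hgfin : P.besovENorm (1 / p) p ∞ g ≠ ∞ :=
    ((P.besovENorm_le hrg).trans_lt hrg.cost_lt_top).ne
  have hgnorm : P.besovNorm (1 / p) p ∞ g = (P.besovENorm (1 / p) p ∞ g).toReal := rfl
  have hA0 : 0 < A := by
    rw [← ENNReal.ofReal_pos]
    refine lt_of_lt_of_le ?_ hA1
    rw [CanonicallyOrderedAdd.mul_pos]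
    refine ⟨by simp, ENNReal.inv_pos.2 (ne_top_of_le_ne_top ENNReal.one_ne_top tsub_le_self)⟩
  have hK0 : 0 ≤ K := by
    rw [hK, hgnorm]
    positivity
  -- The jumps do not depend on the representation of `g`, so their bound passes to the infimum
  -- before `f` enters.
  set N := ENNReal.ofReal A * P.besovENorm (1 / p) p ∞ g with hN
  have hNtop : N ≠ ∞ := ENNReal.mul_ne_top ENNReal.ofReal_ne_top hgfin
  have hjump : ∀ k, P.levelNorm p
      (fun R => ⨍ y in R, (P.cellMean (k + 1) g - P.cellMean k g) y ∂μ) (k + 1) ≤ N := fun k =>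
    P.le_mul_besovENorm ENNReal.ofReal_ne_top ⟨e, b, hrg⟩ fun c a hca => by
      refine (hP.levelNorm_jump_le hp hgp hca k).trans ?_
      rw [← mul_assoc]
      gcongr
  have hKeq : ENNReal.ofReal K =
      N * ENNReal.ofReal (1 - l₂ ^ (1 / p - s))⁻¹ + eLpNorm g ∞ μ := by
    rw [hK, hgnorm, div_eq_mul_inv, ENNReal.ofReal_add (by positivity) (by positivity),
      ENNReal.ofReal_mul (p := A) hA0.le, ENNReal.ofReal_mul ENNReal.toReal_nonneg,
      ENNReal.ofReal_toReal hgfin,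
      ENNReal.ofReal_toReal hg_bdd.2.ne, hN, mul_assoc]
  have main : ∀ f : I → ℂ, P.MemBesov s p q f →
      P.MemBesov s p q (fun x => g x * f x) ∧
        P.besovNorm s p q (fun x => g x * f x) ≤ K * P.besovNorm s p q f := by
    rintro f ⟨hfp, c, a, hr⟩
    obtain ⟨c', a', hr', -⟩ :=
      hP.exists_isRepresentation_mul hp hq hs hsp hgp hg_bdd hrg hfp hr hNtop hjump
    refine ⟨⟨hfp.mul hg_bdd, c', a', hr'⟩, ?_⟩
    have hle : P.besovENorm s p q (fun x => g x * f x) ≤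
        ENNReal.ofReal K * P.besovENorm s p q f :=
      P.le_mul_besovENorm ENNReal.ofReal_ne_top ⟨c, a, hr⟩ fun c a hca => by
        obtain ⟨c', a', hr', hc'⟩ :=
          hP.exists_isRepresentation_mul hp hq hs hsp hgp hg_bdd hrg hfp hca hNtop hjump
        rw [hKeq]
        exact (P.besovENorm_le hr').trans hc'
    have hfin : P.besovENorm s p q f ≠ ∞ := ((P.besovENorm_le hr).trans_lt hr.cost_lt_top).ne
    have := ENNReal.toReal_mono (ENNReal.mul_ne_top ENNReal.ofReal_ne_top hfin) hle
    rwa [ENNReal.toReal_mul, ENNReal.toReal_ofReal hK0] at this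
  refine ⟨main, Real.sSup_le ?_ hK0⟩
  rintro r ⟨f, hf, hf1, rfl⟩
  exact (main f hf).2.trans (mul_le_of_le_one_right hK0 hf1)
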